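/- Let $K$ be an unramified finite extension of $\mathbb{Q}_p$ with ring of integers $O_K$ and absolute value $|\cdot|_K$ extending the $p$-adic one (so $|p|_K=p^{-1}$ and $p$ is a uniformiser). Let $\mathcal R\subset O_K$ be a system of representatives of $O_K/pO_K$ with $0\in\mathcal R$, and let $K^N$ carry the maximum norm $\|\cdot\|_K$ and the Haar measure $dx$ with $\int_{O_K^N}dx=1$. Let $\chi(x)=e^{2\pi i\{\mathrm{Tr}_{K/\mathbb{Q}_p}x\}_p}$ be the standard additive character of $K$ and let $F\psi(y)=\int_{K^N}\chi(y\cdot x)\psi(x)\,dx$ be the Fourier transform on the space $S(K^N)$ of complex-valued locally constant functions with compact support. Let $X\subset O_K^N$ be open and compact, and let $G$ be a finite group acting on $X$ by bi-analytic maps. For $\rho\in\mathbb{N}$ extend each $\sigma\in G$ to $K^N$ as follows: $\sigma=\mathrm{id}$ on $O_K^N\setminus X$; $\sigma(x)=p^{-\rho}\sigma(p^{\rho}x)$ if $1<\|x\|_K\le p^\rho$; $\sigma=\mathrm{id}$ on $\{x:\|x\|_K>p^\rho\}$. Then the following holds for every sufficiently large $\rho$ (depending only on the action of $G$ on $X$)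 for which these extended maps form an action of $G$ on $K^N$. Let $\lambda\in\mathbb{R}$ and let $f\colon K^N\to\mathbb{R}$ be radial (i.e. $f(x)=\tilde f(\|x\|_K)$ for a function $\tilde f$ of the norm), increasing in $\|x\|_K$, equal to $\lambda$ on $O_K^N$, and such that $A_1\|x\|_K^{\gamma_1}\le f(x)\le A_2\|x\|_K^{\gamma_2}$ for all $x$ of sufficiently large norm, with some constants $A_1,A_2,\gamma_1,\gamma_2>0$. For $\sigma\in G$ put $f_\sigma(\xi)=f(\sigma\xi)$ and $J_\sigma\psi=F^{-1}(f_\sigma\cdot F\psi)$. Let $L^2_0(O_K^N)$ be the space of functions in $L^2(O_K^N)$ with integral zero. Then there are functions $\omega_{\gamma bk}\in S(K^N)$ vanishing outside $O_K^N$, indexed by the integers $\gamma\le 0$, the $b\in(p^{\gamma}O_K/O_K)^N\subset(K/O_K)^N$ and the $k\in\mathcal R^N\setminus\{0\}$, such that: 1. the $\omega_{\gamma bk}$ form a complete orthonormal basis of $L^2_0(O_K^N)$, and for every $\sigma\in G$ each of them is an eigenfunction of $J_\sigma$; 2. for every $\sigma\in G$ and every index $(\gamma,b,k)$ there is an integer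 $\gamma_\sigma=\gamma_\sigma(\gamma,b,k)$ with $$J_\sigma\,\omega_{\gamma bk}=\tilde f(p^{1-\gamma_\sigma})\,\omega_{\gamma bk},\qquad p^{1-\gamma_\sigma}=\bigl\|\sigma\bigl(p^{\gamma}(-p^{-1}k+\eta)\bigr)\bigr\|_K\ \text{ for some }\eta\in O_K^N,$$ and $\gamma_{\mathrm{id}}=\gamma$; for fixed $\gamma$ there are only finitely many $\omega_{\gamma bk}$. -/

import Mathlib

open MeasureTheory Metric

namespace TwistedHeat

noncomputable section

/-! ### The local field and its standard additive character -/

/-- A finite extension `K` of `ℚ_p`, with the absolute value extending the `p`-adic one, is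
unramified when `p` is a uniformiser, that is, `p` generates the maximal ideal
`{x | ‖x‖ < 1}` of the ring of integers `{x | ‖x‖ ≤ 1}`. -/
def IsUnramified (p : ℕ) (K : Type*) [NontriviallyNormedField K] : Prop :=
  ∀ x : K, ‖x‖ < 1 → ‖x‖ ≤ ‖(p : K)‖

/-- The ring of integers `O_K`, as an additive subgroup of `K`. -/
def intSubgroup (K : Type*) [NontriviallyNormedField K] [IsUltrametricDist K] :
    AddSubgroup K where
  carrier := {x | ‖x‖ ≤ 1}
  zero_mem' := by simp
  add_mem' := fun {x y} hx hy =>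
    (IsUltrametricDist.norm_add_le_max x y).trans (max_le hx hy)
  neg_mem' := fun {x} hx => by simpa using hx

/-- A system of digits for the uniformiser `p`: representatives of `O_K / p O_K`, the class of
zero being represented by `0`. -/
structure IsDigitSystem (p : ℕ) {K : Type*} [NontriviallyNormedField K] (R : Set K) : Prop where
  zero_mem : (0 : K) ∈ R
  integral : ∀ r ∈ R, ‖r‖ ≤ 1
  existsUnique_digit : ∀ x : K, ‖x‖ ≤ 1 → ∃! r, r ∈ R ∧ ‖x - r‖ ≤ ‖(p : K)‖

section Character

variable (p : ℕ) [Fact p.Prime]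

/-- An exponent `n` with `p ^ n * x ∈ ℤ_p` (the order of the pole of `x`). -/
def poleOrder (x : ℚ_[p]) : ℕ := (-x.valuation).toNat

lemma norm_pow_poleOrder_mul_le (x : ℚ_[p]) : ‖(p : ℚ_[p]) ^ poleOrder p x * x‖ ≤ 1 := by
  rcases eq_or_ne x 0 with rfl | hx
  · simp
  have hp : (1 : ℝ) < p := by exact_mod_cast (Fact.out : p.Prime).one_lt
  have hp0 : (0 : ℝ) < p := by linarith
  rw [norm_mul, Padic.norm_p_pow, Padic.norm_eq_zpow_neg_valuation hx, ← zpow_add₀ hp0.ne']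
  apply zpow_le_one_of_nonpos₀ hp.le
  have := Int.self_le_toNat (-x.valuation)
  unfold poleOrder
  omega

/-- The fractional part `{x}_p ∈ [0, 1) ∩ ℤ[1/p]` of a `p`-adic number: if `p ^ n * x` is a
`p`-adic integer and `0 ≤ a < p ^ n` is its residue modulo `p ^ n`, then `{x}_p = a / p ^ n`. -/
def padicFract (x : ℚ_[p]) : ℝ :=
  (PadicInt.appr ⟨(p : ℚ_[p]) ^ poleOrder p x * x, norm_pow_poleOrder_mul_le p x⟩
    (poleOrder p x) : ℝ) / (p : ℝ) ^ poleOrder p x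

/-- The standard additive character `χ(x) = exp (2 π i {Tr_{K/ℚ_p} x}_p)` of `K`. -/
def stdChar {K : Type*} [NontriviallyNormedField K] [NormedAlgebra ℚ_[p] K] (x : K) : ℂ :=
  Complex.exp (2 * Real.pi * Complex.I * (padicFract p (Algebra.trace ℚ_[p] K x) : ℂ))

end Character

/-! ### Test functions, the Fourier transform, and the operator `J_σ` -/

/-- Test functions: complex valued, locally constant, with compact support. -/
def IsTestFunction {V : Type*} [TopologicalSpace V] (ψ : V → ℂ) : Prop :=
  IsLocallyConstant ψ ∧ HasCompactSupport ψ

section Fourier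

variable (p : ℕ) [Fact p.Prime] {K : Type*} [NontriviallyNormedField K] [NormedAlgebra ℚ_[p] K]
  [MeasurableSpace K] {N : ℕ} (μ : Measure (Fin N → K))

/-- `Fψ(y) = ∫ χ(y · x) ψ(x) dx`. -/
def fourier (ψ : (Fin N → K) → ℂ) (y : Fin N → K) : ℂ :=
  ∫ x, stdChar p (y ⬝ᵥ x) * ψ x ∂μ

/-- `F⁻¹φ(x) = ∫ χ(- x · y) φ(y) dy`. -/
def fourierInv (φ : (Fin N → K) → ℂ) (x : Fin N → K) : ℂ :=
  ∫ y, stdChar p (-(x ⬝ᵥ y)) * φ y ∂μ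

/-- The pseudo-differential operator `J ψ = F⁻¹ (f_s · F ψ)` with symbol `f_s(ξ) = f (s ξ)`, for
a self-map `s` of `K ^ N`. -/
def opJ (f : (Fin N → K) → ℝ) (s : (Fin N → K) → (Fin N → K)) (ψ : (Fin N → K) → ℂ) :
    (Fin N → K) → ℂ :=
  fourierInv p μ fun ξ => (f (s ξ) : ℂ) * fourier p μ ψ ξ

end Fourier

/-- `L²₀`: the square integrable functions with vanishing integral. -/
def meanZeroL2 {α : Type*} [MeasurableSpace α] (ν : Measure α) : Submodule ℂ (Lp ℂ 2 ν) where
  carrier := {g | Integrable g ν ∧ ∫ x, g x ∂ν = 0}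
  zero_mem' := by
    refine ⟨(integrable_congr (Lp.coeFn_zero ℂ 2 ν)).2 (integrable_zero _ _ _), ?_⟩
    rw [integral_congr_ae (Lp.coeFn_zero ℂ 2 ν)]
    simp
  add_mem' := by
    rintro a b ⟨ha, ha0⟩ ⟨hb, hb0⟩
    refine ⟨(integrable_congr (Lp.coeFn_add a b)).2 (ha.add hb), ?_⟩
    rw [integral_congr_ae (Lp.coeFn_add a b)]
    simp only [Pi.add_apply]
    rw [integral_add ha hb, ha0, hb0, add_zero]
  smul_mem' := by
    rintro c a ⟨ha, ha0⟩
    refine ⟨(integrable_congr (Lp.coeFn_smul c a)).2 (ha.smul c), ?_⟩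
    rw [integral_congr_ae (Lp.coeFn_smul c a)]
    simp only [Pi.smul_apply]
    rw [integral_smul, ha0, smul_zero]

/-! ### Radial symbols -/

/-- The conditions on the symbol `f` with parameter `lam`: radial, equal to `lam` on the closed
unit ball, increasing, and between two powers of the norm far away from the origin. -/
structure IsSymbol {V : Type*} [Norm V] (f : V → ℝ) (lam : ℝ) : Prop where
  radial : ∀ x y, ‖x‖ = ‖y‖ → f x = f y
  eq_on_unitBall : ∀ x, ‖x‖ ≤ 1 → f x = lam
  increasing : ∀ x y, ‖x‖ ≤ ‖y‖ → f x ≤ f y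
  growth : ∃ A₁ A₂ g₁ g₂ : ℝ, 0 < A₁ ∧ 0 < A₂ ∧ 0 < g₁ ∧ 0 < g₂ ∧
    ∃ r : ℝ, ∀ x, r ≤ ‖x‖ → A₁ * ‖x‖ ^ g₁ ≤ f x ∧ f x ≤ A₂ * ‖x‖ ^ g₂

open Classical in
/-- The function `f̃` of the norm induced by a radial function `f`: `f̃ ‖x‖ = f x` for radial `f`
(see `radialProfile_norm`). -/
def radialProfile {V : Type*} [Norm V] (f : V → ℝ) (r : ℝ) : ℝ :=
  if h : ∃ x : V, ‖x‖ = r then f h.choose else 0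

lemma radialProfile_norm {V : Type*} [Norm V] {f : V → ℝ}
    (hf : ∀ x y, ‖x‖ = ‖y‖ → f x = f y) (x : V) : radialProfile f ‖x‖ = f x := by
  have h : ∃ y : V, ‖y‖ = ‖x‖ := ⟨x, rfl⟩
  rw [radialProfile, dif_pos h]
  exact hf _ _ h.choose_spec

/-! ### Extension of the action from `X` to `K ^ N` -/

section Extension

variable (p : ℕ) {K : Type*} [NontriviallyNormedField K] {N : ℕ} {G : Type*} [Group G]
  (X : Set (Fin N → K)) [MulAction G X]

open Classical in
/-- `σ` on `X`, and the identity off `X`. -/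
def extUnit (σ : G) (x : Fin N → K) : Fin N → K :=
  if h : x ∈ X then ((σ • (⟨x, h⟩ : X) : X) : Fin N → K) else x

open Classical in
/-- The extension of `σ` to `K ^ N` with parameter `ρ`: on the unit ball it is `σ` on `X` and the
identity off `X`; on the rest of the ball `B_ρ` of radius `p ^ ρ` it is the conjugate
`s⁻¹ ∘ σ ∘ s` by the rescaling `s x = p ^ ρ x`, which maps `B_ρ` onto the unit ball; it is the
identity off `B_ρ`. -/
def ext (ρ : ℕ) (σ : G) (x : Fin N → K) : Fin N → K :=
  if ‖x‖ ≤ 1 then extUnit X σ x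
  else if ‖x‖ ≤ (p : ℝ) ^ ρ then ((p : K) ^ ρ)⁻¹ • extUnit X σ ((p : K) ^ ρ • x)
  else x

/-- The extended maps form an action of `G` on `K ^ N`. -/
def ExtIsAction (ρ : ℕ) : Prop :=
  (∀ x, ext p X ρ (1 : G) x = x) ∧
    ∀ (σ τ : G) (x : Fin N → K), ext p X ρ (σ * τ) x = ext p X ρ σ (ext p X ρ τ x)

end Extension

/-- The set of indices `(γ, b, k)`: an integer `γ ≤ 0`, a class `b ∈ (K / O_K) ^ N` with
coordinates in `p ^ γ O_K / O_K`, and a non-zero vector `k ∈ R ^ N` of digits. -/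
def indexSet (p : ℕ) {K : Type*} [NontriviallyNormedField K] [IsUltrametricDist K]
    (R : Set K) (N : ℕ) : Set (ℤ × (Fin N → K ⧸ intSubgroup K) × (Fin N → K)) :=
  {i | i.1 ≤ 0 ∧
    (∀ j, ∃ y : K, ‖y‖ ≤ (p : ℝ) ^ (-i.1) ∧ (QuotientAddGroup.mk y : K ⧸ intSubgroup K) = i.2.1 j) ∧
    (∀ j, i.2.2 j ∈ R) ∧ i.2.2 ≠ 0}

end

end TwistedHeat

/-! On the unit ball, the character of frequency `-ξ`, extended by zero, has the indicator of `ξ +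
O_K^N` as its Fourier transform. This needs the standard character to be trivial on `O_K` but on no
larger fractional ideal, which for unramified `K` comes from the surjective trace of the residue
fields (`exists_norm_trace_eq_one`). Multiplication by a symbol constant on that coset therefore
only scales the character (`opJ_ballChar`). One frequency per nontrivial coset gives a Hilbert basis
of `L²₀` (`exists_hilbertBasis_ballChar`), and the triples `(γ, b, k)` enumerate these cosets: `γ`
is the size, `k` the leading digit, `b` the remainder (`exists_frequencies`). The functions depend
neither on `σ` nor on `f`.

What remains is that `‖σ y‖` is constant on each nontrivial coset (`exists_forall_norm_ext_eq`). If
the extended maps compose as an action, each `σ` preserves the ball of radius `p^(-ρ)`. For large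
`ρ` this forces `σ 0 = 0` and, by linearity, a norm-nonincreasing derivative at `0`; the same for
`σ⁻¹` makes `σ` an isometry of norms on a ball of radius `δ` independent of `ρ`. Outside that ball,
uniform continuity takes over: rescaled by `p^ρ`, a coset is so small that its image varies by less
than `δ`, while the image has norm above `δ`. -/

namespace TwistedHeat

/-! ### The trace on the ring of integers -/

section Trace

variable (p : ℕ) [Fact p.Prime] (K : Type*) [NontriviallyNormedField K]
  [NormedAlgebra ℚ_[p] K]

/-- `K` as an algebra over `ℤ_p`. -/
@[reducible] noncomputable def padicIntAlgebra : Algebra ℤ_[p] K :=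
  ((algebraMap ℚ_[p] K).comp (algebraMap ℤ_[p] ℚ_[p])).toAlgebra

attribute [local instance] padicIntAlgebra

lemma isScalarTower_padicInt : IsScalarTower ℤ_[p] ℚ_[p] K :=
  IsScalarTower.of_algebraMap_eq' rfl

attribute [local instance] isScalarTower_padicInt

lemma norm_algebraMap_padicInt (a : ℤ_[p]) : ‖algebraMap ℤ_[p] K a‖ = ‖a‖ := by
  change ‖algebraMap ℚ_[p] K (a : ℚ_[p])‖ = _
  rw [norm_algebraMap', PadicInt.norm_def]

variable {K} in
lemma norm_natCast_prime : ‖(p : K)‖ = (p : ℝ)⁻¹ := by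
  rw [← map_natCast (algebraMap ℚ_[p] K) p, norm_algebraMap', Padic.norm_p]

variable [IsUltrametricDist K]

/-- The ring of integers of `K`, as a `ℤ_p`-algebra. -/
def integerAlg : Subalgebra ℤ_[p] K where
  carrier := {x | ‖x‖ ≤ 1}
  mul_mem' := fun {x y} hx hy => by
    simpa using mul_le_one₀ hx (norm_nonneg y) hy
  add_mem' := fun {x y} hx hy =>
    (IsUltrametricDist.norm_add_le_max x y).trans (max_le hx hy)
  algebraMap_mem' := fun a => by
    simpa [norm_algebraMap_padicInt] using PadicInt.norm_le_one a

variable {K}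

/-- This is where unramifiedness enters algebraically: division by `p` keeps a non-unit integral, so
`p O_K` is all of the open unit ball. -/
lemma mem_map_maximalIdeal_iff (hK : IsUnramified p K) (x : integerAlg p K) :
    x ∈ (IsLocalRing.maximalIdeal ℤ_[p]).map (algebraMap ℤ_[p] (integerAlg p K)) ↔
      ‖(x : K)‖ < 1 := by
  have hp0 : (p : K) ≠ 0 := by
    rw [← norm_pos_iff, norm_natCast_prime]
    have := (Fact.out : p.Prime).pos
    positivity
  have hp1 : ‖(p : K)‖ < 1 := by
    rw [norm_natCast_prime]
    exact inv_lt_one_of_one_lt₀ (by exact_mod_cast (Fact.out : p.Prime).one_lt)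
  rw [PadicInt.maximalIdeal_eq_span_p, Ideal.map_span, Set.image_singleton,
    Ideal.mem_span_singleton]
  constructor
  · rintro ⟨y, rfl⟩
    have : ‖(y : K)‖ ≤ 1 := y.2
    simp only [map_natCast, MulMemClass.coe_mul, norm_mul]
    change ‖(p : K)‖ * _ < 1
    nlinarith [norm_nonneg (p : K)]
  · intro hx
    refine ⟨⟨(p : K)⁻¹ * x, ?_⟩, ?_⟩
    · change ‖_‖ ≤ 1
      rw [norm_mul, norm_inv, inv_mul_le_iff₀ (norm_pos_iff.2 hp0), mul_one]
      exact hK _ hx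
    · apply Subtype.ext
      simp only [map_natCast, MulMemClass.coe_mul]
      change (x : K) = (p : K) * _
      field_simp

lemma isMaximal_map_maximalIdeal (hK : IsUnramified p K) :
    ((IsLocalRing.maximalIdeal ℤ_[p]).map
      (algebraMap ℤ_[p] (integerAlg p K))).IsMaximal := by
  rw [Ideal.isMaximal_iff]
  refine ⟨fun h => ?_, fun J x hJ hx hxJ => ?_⟩
  · rw [mem_map_maximalIdeal_iff p hK] at h
    simp at h
  · rw [mem_map_maximalIdeal_iff p hK, not_lt] at hx
    have hx1 : ‖(x : K)‖ = 1 := le_antisymm x.2 hx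
    have hx0 : (x : K) ≠ 0 := by
      rw [← norm_pos_iff, hx1]; exact one_pos
    have : (1 : integerAlg p K) = ⟨(x : K)⁻¹, by change ‖_‖ ≤ 1; simp [hx1]⟩ * x := by
      apply Subtype.ext
      simp [hx0]
    rw [this]
    exact J.mul_mem_left _ hxJ

/-- Coordinates in a basis are continuous, hence bounded on `O_K`. So `O_K` lies in a finitely
generated lattice, and `ℤ_p` is Noetherian. -/
lemma finite_integerAlg [FiniteDimensional ℚ_[p] K] : Module.Finite ℤ_[p] (integerAlg p K) := by
  let b := Module.finBasis ℚ_[p] K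
  obtain ⟨C, hC⟩ : ∃ C : ℝ, ∀ x : K, ∀ i, ‖b.repr x i‖ ≤ C * ‖x‖ := by
    let L := LinearMap.toContinuousLinearMap b.equivFun.toLinearMap
    refine ⟨‖L‖, fun x i => ?_⟩
    exact (norm_le_pi_norm (L x) i).trans (L.le_opNorm x)
  have hp1 : (1 : ℝ) < p := by exact_mod_cast (Fact.out : p.Prime).one_lt
  have hp0 : (p : ℚ_[p]) ≠ 0 := by exact_mod_cast (Fact.out : p.Prime).ne_zero
  obtain ⟨n, hn⟩ := pow_unbounded_of_one_lt C hp1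
  let M : Submodule ℤ_[p] K :=
    Submodule.span ℤ_[p] (Set.range fun i => ((p : ℚ_[p]) ^ n)⁻¹ • b i)
  have hM : M.FG := Submodule.fg_span (Set.finite_range _)
  have hle : (integerAlg p K).toSubmodule ≤ M := by
    intro x hx
    have hx1 : ‖x‖ ≤ 1 := hx
    rw [← b.sum_repr x]
    refine Submodule.sum_mem _ fun i _ => ?_
    have h1 : ‖(p : ℚ_[p]) ^ n * b.repr x i‖ ≤ 1 := by
      rw [norm_mul, Padic.norm_p_pow, zpow_neg, zpow_natCast,
        inv_mul_le_iff₀ (by positivity), mul_one]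
      have := hC x i
      nlinarith [norm_nonneg x, pow_pos (zero_lt_one.trans hp1) n]
    have : b.repr x i • b i =
        (show ℤ_[p] from ⟨(p : ℚ_[p]) ^ n * b.repr x i, h1⟩) • (((p : ℚ_[p]) ^ n)⁻¹ • b i) := by
      rw [← algebraMap_smul ℚ_[p] (show ℤ_[p] from ⟨_, h1⟩), smul_smul]
      congr 1
      change _ = ((p : ℚ_[p]) ^ n * b.repr x i) * _
      field_simp
    rw [this]
    exact M.smul_mem _ (Submodule.subset_span ⟨i, rfl⟩)
  exact Module.Finite.iff_fg.2 (Submodule.FG.of_le hM hle)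

lemma isTorsionFree_integerAlg : Module.IsTorsionFree ℤ_[p] (integerAlg p K) := by
  refine Module.IsTorsionFree.of_smul_eq_zero fun a x h => ?_
  have h1 : algebraMap ℤ_[p] K a * x = 0 := by
    rw [← Algebra.smul_def]
    exact congrArg Subtype.val h
  rcases mul_eq_zero.1 h1 with h2 | h2
  · rw [← norm_eq_zero, norm_algebraMap_padicInt, norm_eq_zero] at h2
    exact Or.inl h2
  · exact Or.inr (Subtype.ext h2)

/-- `K` is the localization of `O_K` at the nonzero elements of `ℤ_p`, and the trace of a finite
free module commutes with localization. Freeness comes from finiteness and torsion-freeness over a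
principal ideal domain. -/
lemma trace_coe_integerAlg [FiniteDimensional ℚ_[p] K] (x : integerAlg p K) :
    Algebra.trace ℚ_[p] K (x : K) = (Algebra.trace ℤ_[p] (integerAlg p K) x : ℚ_[p]) := by
  have := finite_integerAlg p (K := K)
  have := isTorsionFree_integerAlg p (K := K)
  have : IsLocalization (Algebra.algebraMapSubmonoid (integerAlg p K) (nonZeroDivisors ℤ_[p])) K := by
    refine (isLocalization_iff _ _).2 ⟨?_, fun z => ?_, fun {x y} h => ⟨1, ?_⟩⟩
    · rintro ⟨_, a, ha, rfl⟩
      refine (Ne.isUnit fun h => nonZeroDivisors.ne_zero ha ?_)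
      have h2 : ‖algebraMap ℤ_[p] K a‖ = 0 := by
        rw [norm_eq_zero]; exact h
      rwa [norm_algebraMap_padicInt, norm_eq_zero] at h2
    · have hp1 : (1 : ℝ) < p := by exact_mod_cast (Fact.out : p.Prime).one_lt
      obtain ⟨n, hn⟩ := pow_unbounded_of_one_lt ‖z‖ hp1
      have hz : ‖(p : K) ^ n * z‖ ≤ 1 := by
        rw [norm_mul, norm_pow, norm_natCast_prime, inv_pow,
          inv_mul_le_iff₀ (by positivity), mul_one]
        exact hn.le
      refine ⟨⟨⟨_, hz⟩, ⟨algebraMap _ _ ((p : ℤ_[p]) ^ n), _,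
        mem_nonZeroDivisors_of_ne_zero ?_, rfl⟩⟩, ?_⟩
      · exact pow_ne_zero _ (by exact_mod_cast (Fact.out : p.Prime).ne_zero)
      · rw [mul_comm]
        simp only [map_pow, map_natCast]
        rfl
    · have : (x : K) = y := h
      rw [Subtype.ext this]
  exact Algebra.trace_localization ℤ_[p] (nonZeroDivisors ℤ_[p]) x

lemma norm_trace_le_one [FiniteDimensional ℚ_[p] K] {x : K} (hx : ‖x‖ ≤ 1) :
    ‖Algebra.trace ℚ_[p] K x‖ ≤ 1 := by
  rw [trace_coe_integerAlg p (⟨x, hx⟩ : integerAlg p K)]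
  exact PadicInt.norm_le_one _

/-- The trace reduces modulo `p` to the trace of the residue extension. That extension is separable,
since finite fields are perfect, so some integer has residual trace `1`. -/
lemma exists_norm_trace_eq_one [FiniteDimensional ℚ_[p] K] (hK : IsUnramified p K) :
    ∃ x : K, ‖x‖ ≤ 1 ∧ ‖Algebra.trace ℚ_[p] K x‖ = 1 := by
  have := finite_integerAlg p (K := K)
  have := isTorsionFree_integerAlg p (K := K)
  have := isMaximal_map_maximalIdeal p hK
  let := Ideal.Quotient.field (IsLocalRing.maximalIdeal ℤ_[p])
  let := Ideal.Quotient.field ((IsLocalRing.maximalIdeal ℤ_[p]).map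
      (algebraMap ℤ_[p] (integerAlg p K)))
  have : Finite (ℤ_[p] ⧸ IsLocalRing.maximalIdeal ℤ_[p]) :=
    Finite.of_equiv _ (PadicInt.residueField (p := p)).symm.toEquiv
  have : Module.Finite (ℤ_[p] ⧸ IsLocalRing.maximalIdeal ℤ_[p])
    (integerAlg p K ⧸ (IsLocalRing.maximalIdeal ℤ_[p]).map
      (algebraMap ℤ_[p] (integerAlg p K))) :=
    Module.Finite.of_restrictScalars_finite ℤ_[p] _ _
  have : Algebra.IsAlgebraic (ℤ_[p] ⧸ IsLocalRing.maximalIdeal ℤ_[p])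
    (integerAlg p K ⧸ (IsLocalRing.maximalIdeal ℤ_[p]).map
      (algebraMap ℤ_[p] (integerAlg p K))) :=
    Algebra.IsAlgebraic.of_finite _ _
  have : Algebra.IsSeparable (ℤ_[p] ⧸ IsLocalRing.maximalIdeal ℤ_[p])
    (integerAlg p K ⧸ (IsLocalRing.maximalIdeal ℤ_[p]).map
      (algebraMap ℤ_[p] (integerAlg p K))) :=
    Algebra.IsAlgebraic.isSeparable_of_perfectField
  have hne := Algebra.trace_surjective (ℤ_[p] ⧸ IsLocalRing.maximalIdeal ℤ_[p])
    (integerAlg p K ⧸ (IsLocalRing.maximalIdeal ℤ_[p]).map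
      (algebraMap ℤ_[p] (integerAlg p K)))
  obtain ⟨y, hy⟩ := hne 1
  obtain ⟨x, rfl⟩ := Ideal.Quotient.mk_surjective y
  refine ⟨x, x.2, ?_⟩
  rw [trace_coe_integerAlg]
  have h1 := Algebra.trace_quotient_mk (R := ℤ_[p]) x
  have h2 : Algebra.trace ℤ_[p] (integerAlg p K) x ∉ IsLocalRing.maximalIdeal ℤ_[p] := by
    rw [← Ideal.Quotient.eq_zero_iff_mem, ← h1, hy]
    exact one_ne_zero
  rw [IsLocalRing.mem_maximalIdeal, PadicInt.mem_nonunits, not_lt] at h2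
  exact le_antisymm (PadicInt.norm_le_one _) h2

end Trace

lemma norm_sub_le_max {V : Type*} [SeminormedAddCommGroup V] [IsUltrametricDist V] (x y : V) :
    ‖x - y‖ ≤ max ‖x‖ ‖y‖ := by
  simpa [sub_eq_add_neg] using IsUltrametricDist.norm_add_le_max x (-y)

/-! ### The `p`-adic fractional part modulo integers -/

section FractionalPart

variable (p : ℕ) [Fact p.Prime]

lemma exists_padicFract_eq (x : ℚ_[p]) : ∃ (a : ℤ) (n : ℕ),
    padicFract p x = a / (p : ℝ) ^ n ∧ ‖x - a / (p : ℚ_[p]) ^ n‖ ≤ 1 := by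
  have hp : (p : ℚ_[p]) ≠ 0 := by exact_mod_cast (Fact.out : p.Prime).ne_zero
  set n := poleOrder p x
  set z : ℤ_[p] := ⟨(p : ℚ_[p]) ^ n * x, norm_pow_poleOrder_mul_le p x⟩
  refine ⟨(z.appr n : ℕ), n, by simp [padicFract, z, n], ?_⟩
  obtain ⟨c, hc⟩ := Ideal.mem_span_singleton.1 (PadicInt.appr_spec n z)
  have h1 : (p : ℚ_[p]) ^ n * x - (z.appr n : ℕ) = (p : ℚ_[p]) ^ n * c := by
    have := congrArg (fun w : ℤ_[p] => (w : ℚ_[p])) hc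
    rw [PadicInt.coe_sub, PadicInt.coe_mul] at this
    push_cast at this
    exact this
  have h2 : x - ((z.appr n : ℕ) : ℤ) / (p : ℚ_[p]) ^ n = c := by
    push_cast
    field_simp
    linear_combination h1
  rw [h2]
  exact PadicInt.norm_le_one c

lemma exists_int_of_norm_div_pow_le_one {a : ℤ} {n : ℕ} (h : ‖(a / (p : ℚ_[p]) ^ n)‖ ≤ 1) :
    ∃ m : ℤ, a = p ^ n * m := by
  have hp := (Fact.out : p.Prime).pos
  have : (p : ℤ) ^ n ∣ a := by
    rw [← Padic.norm_int_le_pow_iff_dvd]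
    rw [norm_div, Padic.norm_p_pow, div_le_iff₀ (by positivity), one_mul] at h
    exact h
  simpa [dvd_def] using this

/-- Since `ℤ[1/p] ∩ ℤ_p = ℤ`, two approximations of `x` modulo `ℤ_p` differ by an integer. Any of
them may thus replace the canonical residue. -/
lemma exp_padicFract_eq {x : ℚ_[p]} {a : ℤ} {n : ℕ} (h : ‖x - a / (p : ℚ_[p]) ^ n‖ ≤ 1) :
    Complex.exp (2 * Real.pi * Complex.I * (padicFract p x : ℂ)) =
      Complex.exp (2 * Real.pi * Complex.I * (a / (p : ℂ) ^ n)) := by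
  obtain ⟨b, m, hb, hx⟩ := exists_padicFract_eq p x
  have hp : (p : ℚ_[p]) ≠ 0 := by exact_mod_cast (Fact.out : p.Prime).ne_zero
  have hpc : (p : ℂ) ≠ 0 := by exact_mod_cast (Fact.out : p.Prime).ne_zero
  have h3 : ‖(((b * p ^ n - a * p ^ m : ℤ) : ℚ_[p]) / (p : ℚ_[p]) ^ (m + n))‖ ≤ 1 := by
    have : (((b * p ^ n - a * p ^ m : ℤ) : ℚ_[p]) / (p : ℚ_[p]) ^ (m + n)) =
        (x - a / (p : ℚ_[p]) ^ n) - (x - b / (p : ℚ_[p]) ^ m) := by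
      push_cast
      field_simp
      ring
    rw [this]
    exact (norm_sub_le_max _ _).trans (max_le h hx)
  obtain ⟨k, hk⟩ := exists_int_of_norm_div_pow_le_one p h3
  rw [hb, Complex.exp_eq_exp_iff_exists_int]
  refine ⟨k, ?_⟩
  have hk' : ((b : ℂ) * p ^ n - a * p ^ m) = p ^ (m + n) * k := by exact_mod_cast hk
  push_cast
  have h5 : (b : ℂ) / p ^ m = a / p ^ n + k := by
    field_simp
    rw [pow_add] at hk'
    linear_combination hk'
  rw [h5]
  ring

lemma exp_padicFract_add (x y : ℚ_[p]) :
    Complex.exp (2 * Real.pi * Complex.I * (padicFract p (x + y) : ℂ)) =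
      Complex.exp (2 * Real.pi * Complex.I * (padicFract p x : ℂ)) *
        Complex.exp (2 * Real.pi * Complex.I * (padicFract p y : ℂ)) := by
  obtain ⟨a, m, -, hx⟩ := exists_padicFract_eq p x
  obtain ⟨b, n, -, hy⟩ := exists_padicFract_eq p y
  have hp : (p : ℚ_[p]) ≠ 0 := by exact_mod_cast (Fact.out : p.Prime).ne_zero
  have hpc : (p : ℂ) ≠ 0 := by exact_mod_cast (Fact.out : p.Prime).ne_zero
  have hxy : ‖(x + y) - ((a * p ^ n + b * p ^ m : ℤ) : ℚ_[p]) / (p : ℚ_[p]) ^ (m + n)‖ ≤ 1 := by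
    have : (x + y) - ((a * p ^ n + b * p ^ m : ℤ) : ℚ_[p]) / (p : ℚ_[p]) ^ (m + n) =
        (x - a / (p : ℚ_[p]) ^ m) + (y - b / (p : ℚ_[p]) ^ n) := by
      push_cast
      field_simp
      ring
    rw [this]
    exact (IsUltrametricDist.norm_add_le_max _ _).trans (max_le hx hy)
  rw [exp_padicFract_eq p hx, exp_padicFract_eq p hy, exp_padicFract_eq p hxy, ← Complex.exp_add]
  congr 1
  push_cast
  field_simp
  ring

lemma exp_padicFract_eq_one_iff (x : ℚ_[p]) :
    Complex.exp (2 * Real.pi * Complex.I * (padicFract p x : ℂ)) = 1 ↔ ‖x‖ ≤ 1 := by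
  constructor
  · intro h
    obtain ⟨a, n, ha, hx⟩ := exists_padicFract_eq p x
    rw [Complex.exp_eq_one_iff] at h
    obtain ⟨k, hk⟩ := h
    have h2 : ((2 : ℂ) * Real.pi * Complex.I) ≠ 0 := Complex.two_pi_I_ne_zero
    have h1 : (padicFract p x : ℂ) = k := by
      apply mul_left_cancel₀ h2
      rw [hk]; ring
    have h3 : padicFract p x = k := by exact_mod_cast h1
    have hpr : (p : ℝ) ≠ 0 := by exact_mod_cast (Fact.out : p.Prime).ne_zero
    have hpq : (p : ℚ_[p]) ≠ 0 := by exact_mod_cast (Fact.out : p.Prime).ne_zero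
    rw [ha, div_eq_iff (pow_ne_zero _ hpr)] at h3
    have h4 : a = k * p ^ n := by exact_mod_cast h3
    have h5 : (a : ℚ_[p]) / (p : ℚ_[p]) ^ n = (k : ℤ) := by
      rw [h4]; push_cast; field_simp
    rw [h5] at hx
    have : x = (x - (k : ℤ)) + (k : ℤ) := by ring
    rw [this]
    exact (IsUltrametricDist.norm_add_le_max _ _).trans (max_le hx (Padic.norm_int_le_one k))
  · intro h
    rw [exp_padicFract_eq p (a := 0) (n := 0) (by simpa using h)]
    simp

end FractionalPart

/-! ### The standard character and its conductor -/

section Character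

variable (p : ℕ) [Fact p.Prime] {K : Type*} [NontriviallyNormedField K]
  [NormedAlgebra ℚ_[p] K]

lemma stdChar_add (x y : K) : stdChar p (x + y) = stdChar p x * stdChar p y := by
  simp only [stdChar, map_add]
  exact exp_padicFract_add p _ _

lemma norm_stdChar (x : K) : ‖stdChar p x‖ = 1 := by
  rw [stdChar, mul_right_comm, ← Complex.norm_exp_ofReal_mul_I
    (2 * Real.pi * padicFract p (Algebra.trace ℚ_[p] K x))]
  push_cast
  ring_nf

lemma stdChar_ne_zero (x : K) : stdChar p x ≠ 0 := Complex.exp_ne_zero _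

lemma stdChar_zero : stdChar p (0 : K) = 1 := by
  have := stdChar_add p (0 : K) 0
  rw [add_zero] at this
  exact (mul_eq_left₀ (stdChar_ne_zero p _)).1 this.symm

lemma stdChar_neg (x : K) : stdChar p (-x) = starRingEnd ℂ (stdChar p x) := by
  have h := stdChar_add p x (-x)
  rw [add_neg_cancel, stdChar_zero] at h
  rw [← Complex.inv_eq_conj (norm_stdChar p x)]
  exact eq_inv_of_mul_eq_one_right h.symm

variable [IsUltrametricDist K] [FiniteDimensional ℚ_[p] K]

lemma stdChar_eq_one {x : K} (hx : ‖x‖ ≤ 1) : stdChar p x = 1 :=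
  (exp_padicFract_eq_one_iff p _).2 (norm_trace_le_one p hx)

lemma stdChar_eq_of_norm_sub_le {x y : K} (h : ‖x - y‖ ≤ 1) : stdChar p x = stdChar p y := by
  rw [← sub_add_cancel x y, stdChar_add, stdChar_eq_one p h, one_mul]

lemma isLocallyConstant_stdChar : IsLocallyConstant (stdChar p : K → ℂ) := by
  rw [IsLocallyConstant.iff_eventually_eq]
  intro x
  filter_upwards [closedBall_mem_nhds x one_pos] with y hy
  exact stdChar_eq_of_norm_sub_le p (by simpa [dist_eq_norm] using hy)

variable {p}

lemma exists_stdChar_mul_ne_one (hK : IsUnramified p K) {y : K} (hy : 1 < ‖y‖) :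
    ∃ z : K, ‖z‖ ≤ 1 ∧ stdChar p (y * z) ≠ 1 := by
  obtain ⟨t, ht, htr⟩ := exists_norm_trace_eq_one p hK
  have hp1 : (1 : ℝ) < p := by exact_mod_cast (Fact.out : p.Prime).one_lt
  have hy0 : y ≠ 0 := by rw [← norm_pos_iff]; linarith
  -- With this witness `y z = p⁻¹ t`, whose trace has norm `p`. It is integral because `‖y⁻¹‖ < 1`
  -- already gives `‖y⁻¹‖ ≤ p⁻¹`.
  refine ⟨y⁻¹ * ((p : ℚ_[p])⁻¹ • t), ?_, ?_⟩
  · have h1 := hK y⁻¹ (by rw [norm_inv]; exact inv_lt_one_of_one_lt₀ hy)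
    rw [norm_natCast_prime] at h1
    rw [norm_mul, norm_smul, norm_inv (p : ℚ_[p]), Padic.norm_p, inv_inv]
    calc ‖y⁻¹‖ * (p * ‖t‖) ≤ (p : ℝ)⁻¹ * (p * 1) := by gcongr
      _ = 1 := by field_simp
  · rw [mul_inv_cancel_left₀ hy0, stdChar, Ne, exp_padicFract_eq_one_iff, map_smul, norm_smul,
      htr, norm_inv, Padic.norm_p, inv_inv, mul_one, not_le]
    exact hp1

end Character

/-! ### Values of the norm and ultrametric estimates -/

section Norm

variable {p : ℕ} [Fact p.Prime] {K : Type*} [NontriviallyNormedField K]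
  [NormedAlgebra ℚ_[p] K] {N : ℕ}

lemma exists_norm_apply_eq {x : Fin N → K} (hx : x ≠ 0) : ∃ j, ‖x j‖ = ‖x‖ := by
  obtain ⟨i, -⟩ := Function.ne_iff.1 hx
  have : Nonempty (Fin N) := ⟨i⟩
  obtain ⟨j, hj⟩ := Finite.exists_max fun j => ‖x j‖
  exact ⟨j, le_antisymm (norm_le_pi_norm x j) ((pi_norm_le_iff_of_nonempty _).2 hj)⟩

lemma exists_norm_eq_zpow (hK : IsUnramified p K) {x : K} (hx : x ≠ 0) :
    ∃ m : ℤ, ‖x‖ = (p : ℝ) ^ m := by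
  have hp1 : (1 : ℝ) < p := by exact_mod_cast (Fact.out : p.Prime).one_lt
  have hp0 : (0 : ℝ) < p := by linarith
  obtain ⟨m, hm1, hm2⟩ := exists_mem_Ico_zpow (norm_pos_iff.2 hx) hp1
  refine ⟨m, le_antisymm ?_ hm1⟩
  have h := hK ((p : K) ^ (m + 1) * x)
  rw [norm_mul, norm_zpow, norm_natCast_prime, inv_zpow, inv_mul_lt_iff₀ (by positivity),
    inv_mul_le_iff₀ (by positivity), mul_one, zpow_add_one₀ hp0.ne',
    mul_inv_cancel_right₀ hp0.ne'] at h
  refine h ?_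
  rwa [← zpow_add_one₀ hp0.ne']

lemma exists_pi_norm_eq_zpow (hK : IsUnramified p K) {x : Fin N → K} (hx : x ≠ 0) :
    ∃ m : ℤ, ‖x‖ = (p : ℝ) ^ m := by
  obtain ⟨j, hj⟩ := exists_norm_apply_eq hx
  rw [← hj]
  refine exists_norm_eq_zpow hK ?_
  rw [← norm_pos_iff, hj]
  exact norm_pos_iff.2 hx

variable [IsUltrametricDist K]

lemma norm_dotProduct_le (x y : Fin N → K) : ‖x ⬝ᵥ y‖ ≤ ‖x‖ * ‖y‖ := by
  refine IsUltrametricDist.norm_sum_le_of_forall_le_of_nonneg (by positivity) fun i _ => ?_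
  rw [norm_mul]
  gcongr <;> exact norm_le_pi_norm _ i

lemma norm_eq_of_norm_sub_lt {V : Type*} [SeminormedAddCommGroup V] [IsUltrametricDist V]
    {x y : V} (h : ‖x - y‖ < ‖y‖) : ‖x‖ = ‖y‖ := by
  rw [← sub_add_cancel x y, IsUltrametricDist.norm_add_eq_max_of_norm_ne_norm h.ne,
    max_eq_right h.le]

end Norm

/-! ### Integrals of characters over balls -/

section Orthogonality

variable {p : ℕ} [Fact p.Prime] {K : Type*} [NontriviallyNormedField K] [IsUltrametricDist K]
  [NormedAlgebra ℚ_[p] K] [FiniteDimensional ℚ_[p] K] {N : ℕ}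

lemma exists_stdChar_dotProduct_ne_one (hK : IsUnramified p K) {t : K} {y : Fin N → K}
    (h : 1 < ‖t‖ * ‖y‖) :
    ∃ x : Fin N → K, x ∈ closedBall (0 : Fin N → K) ‖t‖ ∧ stdChar p (y ⬝ᵥ x) ≠ 1 := by
  have hy : y ≠ 0 := by
    rintro rfl
    simp at h
    linarith
  obtain ⟨j, hj⟩ := exists_norm_apply_eq hy
  obtain ⟨z, hz, hχ⟩ := exists_stdChar_mul_ne_one (p := p) hK (y := t * y j)
    (by rwa [norm_mul, hj])
  refine ⟨Pi.single j (t * z), ?_, ?_⟩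
  · rw [mem_closedBall_zero_iff, Pi.norm_single, norm_mul]
    exact mul_le_of_le_one_right (norm_nonneg _) hz
  · rw [dotProduct_single]
    rwa [show y j * (t * z) = t * y j * z by ring]

lemma isLocallyConstant_stdChar_dotProduct (y : Fin N → K) :
    IsLocallyConstant fun x : Fin N → K => stdChar p (y ⬝ᵥ x) :=
  (isLocallyConstant_stdChar p).comp_continuous (by unfold dotProduct; fun_prop)

variable [MeasurableSpace K] [BorelSpace K] [SecondCountableTopology K] (μ : Measure (Fin N → K))

lemma setIntegral_stdChar_of_le {t : K} {y : Fin N → K} (h : ‖t‖ * ‖y‖ ≤ 1) :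
    ∫ x in closedBall (0 : Fin N → K) ‖t‖, stdChar p (y ⬝ᵥ x) ∂μ =
      μ.real (closedBall 0 ‖t‖) := by
  rw [setIntegral_congr_fun (g := fun _ => (1 : ℂ)) measurableSet_closedBall]
  · simp
  · intro x hx
    refine stdChar_eq_one p ((norm_dotProduct_le _ _).trans ?_)
    rw [mem_closedBall_zero_iff] at hx
    nlinarith [norm_nonneg y]

/-- Translating by a point of the ball where the character is not `1` preserves the integral and
also multiplies it by that value. -/
lemma setIntegral_stdChar_of_lt [μ.IsAddHaarMeasure] (hK : IsUnramified p K) {t : K} {y : Fin N → K}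
    (h : 1 < ‖t‖ * ‖y‖) :
    ∫ x in closedBall (0 : Fin N → K) ‖t‖, stdChar p (y ⬝ᵥ x) ∂μ = 0 := by
  obtain ⟨x₀, hx₀, hχ⟩ := exists_stdChar_dotProduct_ne_one (p := p) hK h
  rw [← integral_indicator measurableSet_closedBall]
  set F : (Fin N → K) → ℂ := (closedBall 0 ‖t‖).indicator fun x => stdChar p (y ⬝ᵥ x) with hF
  have h1 : ∀ x, F (x + x₀) = stdChar p (y ⬝ᵥ x₀) * F x := by
    intro x
    have hmem : x + x₀ ∈ closedBall (0 : Fin N → K) ‖t‖ ↔ x ∈ closedBall (0 : Fin N → K) ‖t‖ := by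
      simp only [mem_closedBall_zero_iff] at hx₀ ⊢
      constructor
      · intro hx
        rw [← add_sub_cancel_right x x₀]
        exact (norm_sub_le_max _ _).trans (max_le hx hx₀)
      · exact fun hx => (IsUltrametricDist.norm_add_le_max _ _).trans (max_le hx hx₀)
    by_cases hx : x ∈ closedBall (0 : Fin N → K) ‖t‖
    · rw [hF, Set.indicator_of_mem hx, Set.indicator_of_mem (hmem.2 hx), dotProduct_add,
        stdChar_add, mul_comm]
    · rw [hF, Set.indicator_of_notMem hx, Set.indicator_of_notMem (mt hmem.1 hx), mul_zero]
  have h2 := integral_add_right_eq_self (μ := μ) F x₀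
  simp only [h1] at h2
  rw [integral_const_mul] at h2
  by_contra hne
  exact hχ ((mul_eq_right₀ hne).1 h2)

end Orthogonality

/-! ### Characters of the unit ball as eigenfunctions -/

section BallChar

variable (p : ℕ) [Fact p.Prime] {K : Type*} [NontriviallyNormedField K]
  [NormedAlgebra ℚ_[p] K] {N : ℕ}

/-- The character of the unit ball of `K ^ N` with frequency `-ξ`, extended by zero. Its Fourier
transform is the indicator of the coset `ξ + O_K ^ N`. -/
noncomputable def ballChar (ξ : Fin N → K) : (Fin N → K) → ℂ :=
  (closedBall 0 1).indicator fun x => stdChar p (-(ξ ⬝ᵥ x))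

lemma ballChar_of_mem (ξ : Fin N → K) {x : Fin N → K} (hx : x ∈ closedBall (0 : Fin N → K) 1) :
    ballChar p ξ x = stdChar p (-(ξ ⬝ᵥ x)) := Set.indicator_of_mem hx _

lemma ballChar_of_notMem (ξ : Fin N → K) {x : Fin N → K}
    (hx : x ∉ closedBall (0 : Fin N → K) 1) : ballChar p ξ x = 0 := Set.indicator_of_notMem hx _

variable {p} [IsUltrametricDist K] [FiniteDimensional ℚ_[p] K]

lemma isTestFunction_ballChar [ProperSpace K] (ξ : Fin N → K) : IsTestFunction (ballChar p ξ) := by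
  refine ⟨?_, HasCompactSupport.intro (isCompact_closedBall 0 1)
    fun x hx => ballChar_of_notMem p ξ hx⟩
  have hc := IsUltrametricDist.isClopen_closedBall (0 : Fin N → K) one_ne_zero
  rw [IsLocallyConstant.iff_eventually_eq]
  intro x
  by_cases hx : x ∈ closedBall (0 : Fin N → K) 1
  · filter_upwards [hc.isOpen.mem_nhds hx,
      (isLocallyConstant_stdChar_dotProduct (p := p) (-ξ)).eventually_eq x] with y hy hyx
    rw [ballChar_of_mem p ξ hx, ballChar_of_mem p ξ hy, ← neg_dotProduct, ← neg_dotProduct, hyx]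
  · filter_upwards [hc.compl.isOpen.mem_nhds hx] with y hy
    rw [ballChar_of_notMem p ξ hx, ballChar_of_notMem p ξ hy]

variable [MeasurableSpace K] [BorelSpace K] [SecondCountableTopology K]
  (μ : Measure (Fin N → K)) [μ.IsAddHaarMeasure]

lemma setIntegral_unitBall_stdChar (hK : IsUnramified p K) (hμ : μ (closedBall 0 1) = 1)
    (y : Fin N → K) :
    ∫ x in closedBall (0 : Fin N → K) 1, stdChar p (y ⬝ᵥ x) ∂μ =
      (closedBall (0 : Fin N → K) 1).indicator 1 y := by
  by_cases hy : y ∈ closedBall (0 : Fin N → K) 1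
  · rw [Set.indicator_of_mem hy]
    rw [mem_closedBall_zero_iff] at hy
    have := setIntegral_stdChar_of_le (p := p) μ (t := (1 : K)) (y := y) (by simpa using hy)
    simpa [Measure.real, hμ] using this
  · rw [Set.indicator_of_notMem hy]
    rw [mem_closedBall_zero_iff, not_le] at hy
    have := setIntegral_stdChar_of_lt μ hK (t := (1 : K)) (y := y) (by simpa using hy)
    simpa using this

lemma fourier_ballChar (hK : IsUnramified p K) (hμ : μ (closedBall 0 1) = 1)
    (ξ y : Fin N → K) :
    fourier p μ (ballChar p ξ) y = (closedBall (0 : Fin N → K) 1).indicator 1 (y - ξ) := by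
  rw [← setIntegral_unitBall_stdChar μ hK hμ, ← integral_indicator measurableSet_closedBall,
    fourier]
  congr 1 with x
  by_cases hx : x ∈ closedBall (0 : Fin N → K) 1
  · rw [ballChar_of_mem p ξ hx, Set.indicator_of_mem hx, ← stdChar_add, sub_dotProduct,
      sub_eq_add_neg]
  · rw [ballChar_of_notMem p ξ hx, Set.indicator_of_notMem hx, mul_zero]

/-- A character of the unit ball is an eigenfunction of `opJ` as soon as the symbol is constant on
the coset of its frequency. -/
lemma opJ_ballChar (hK : IsUnramified p K) (hμ : μ (closedBall 0 1) = 1)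
    {f : (Fin N → K) → ℝ} {s : (Fin N → K) → (Fin N → K)} {ξ : Fin N → K} {c : ℝ}
    (hf : ∀ y, ‖y - ξ‖ ≤ 1 → f (s y) = c) :
    opJ p μ f s (ballChar p ξ) = fun x => (c : ℂ) * ballChar p ξ x := by
  funext x
  -- Shifting by `ξ` moves the support of the Fourier transform to the unit ball, where the
  -- character integral is known.
  rw [opJ, fourierInv, ← integral_add_right_eq_self _ ξ]
  have h1 : ∀ y, stdChar p (-(x ⬝ᵥ (y + ξ))) *
      ((f (s (y + ξ)) : ℂ) * fourier p μ (ballChar p ξ) (y + ξ)) =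
      (c * stdChar p (-(ξ ⬝ᵥ x))) *
        (closedBall (0 : Fin N → K) 1).indicator (fun y => stdChar p (-x ⬝ᵥ y)) y := by
    intro y
    rw [fourier_ballChar μ hK hμ, add_sub_cancel_right]
    by_cases hy : y ∈ closedBall (0 : Fin N → K) 1
    · rw [Set.indicator_of_mem hy, Set.indicator_of_mem hy,
        hf _ (by simpa using hy), dotProduct_add, neg_add, stdChar_add, dotProduct_comm x ξ,
        neg_dotProduct, Pi.one_apply]
      ring
    · rw [Set.indicator_of_notMem hy, Set.indicator_of_notMem hy, mul_zero, mul_zero, mul_zero]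
  simp only [h1]
  rw [integral_const_mul, integral_indicator measurableSet_closedBall,
    setIntegral_unitBall_stdChar μ hK hμ, mul_assoc]
  congr 1
  have hneg : -x ∈ closedBall (0 : Fin N → K) 1 ↔ x ∈ closedBall (0 : Fin N → K) 1 := by
    simp
  by_cases hx : x ∈ closedBall (0 : Fin N → K) 1
  · rw [Set.indicator_of_mem (hneg.2 hx), ballChar_of_mem p ξ hx, Pi.one_apply, mul_one]
  · rw [Set.indicator_of_notMem (mt hneg.1 hx), ballChar_of_notMem p ξ hx, mul_zero]

end BallChar

/-! ### The space of mean-zero functions -/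

section MeanZero

variable {α : Type*} [MeasurableSpace α] {ν : Measure α} [IsFiniteMeasure ν]

lemma mem_meanZeroL2_iff (g : Lp ℂ 2 ν) : g ∈ meanZeroL2 ν ↔ ∫ x, g x ∂ν = 0 :=
  ⟨fun h => h.2, fun h => ⟨(Lp.memLp g).integrable (by norm_num), h⟩⟩

/-- Over a finite measure the constant `1` is square integrable, and the subspace is its orthogonal
complement. -/
lemma isClosed_meanZeroL2 : IsClosed (meanZeroL2 ν : Set (Lp ℂ 2 ν)) := by
  have : (meanZeroL2 ν : Set (Lp ℂ 2 ν)) =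
      {g | inner ℂ (indicatorConstLp 2 MeasurableSet.univ (measure_ne_top ν _) (1 : ℂ)) g = 0} := by
    ext g
    rw [Set.mem_ofPred_eq, L2.inner_indicatorConstLp_one, Measure.restrict_univ, SetLike.mem_coe,
      mem_meanZeroL2_iff]
  rw [this]
  exact isClosed_eq (by fun_prop) continuous_const

lemma completeSpace_meanZeroL2 : CompleteSpace (meanZeroL2 ν) :=
  isClosed_meanZeroL2.completeSpace_coe

end MeanZero

/-! ### Closed balls as a generating π-system -/

section BallGenerate

/-- An integrable function on an ultrametric space is almost everywhere zero if its integrals over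
the small closed balls and over the whole space vanish. -/
lemma ae_eq_zero_of_forall_setIntegral_closedBall {V : Type*} [MetricSpace V]
    [IsUltrametricDist V] [SecondCountableTopology V] [MeasurableSpace V] [BorelSpace V]
    {ν : Measure V} {g : V → ℂ} (hg : Integrable g ν) (S : Set ℝ) (hS : ∀ r ∈ S, 0 < r)
    (hS' : ∀ ε > 0, ∃ r ∈ S, r < ε) (h0 : ∫ x, g x ∂ν = 0)
    (hball : ∀ a, ∀ r ∈ S, ∫ x in closedBall a r, g x ∂ν = 0) : g =ᵐ[ν] 0 := by
  let C : Set (Set V) := {s | ∃ a, ∃ r ∈ S, s = closedBall a r}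
  have hbasis : TopologicalSpace.IsTopologicalBasis C := by
    refine TopologicalSpace.isTopologicalBasis_of_isOpen_of_nhds ?_ ?_
    · rintro _ ⟨a, r, hr, rfl⟩
      exact IsUltrametricDist.isOpen_closedBall a (hS r hr).ne'
    · intro a u ha hu
      obtain ⟨ε, hε, hεu⟩ := Metric.isOpen_iff.1 hu a ha
      obtain ⟨r, hr, hrε⟩ := hS' ε hε
      exact ⟨_, ⟨a, r, hr, rfl⟩, mem_closedBall_self (hS r hr).le,
        (closedBall_subset_ball hrε).trans hεu⟩
  -- Two ultrametric balls that meet are nested.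
  have hpi : IsPiSystem C := by
    rintro _ ⟨a, r, hr, rfl⟩ _ ⟨b, s, hs, rfl⟩ ⟨z, hza, hzb⟩
    rw [IsUltrametricDist.closedBall_eq_of_mem hza, IsUltrametricDist.closedBall_eq_of_mem hzb]
    rcases le_total r s with hrs | hrs
    · exact ⟨z, r, hr, Set.inter_eq_left.2 (closedBall_subset_closedBall hrs)⟩
    · exact ⟨z, s, hs, Set.inter_eq_right.2 (closedBall_subset_closedBall hrs)⟩
  refine hg.ae_eq_zero_of_forall_setIntegral_eq_zero fun s hs _ => ?_
  refine MeasurableSpace.induction_on_inter (C := fun s _ => ∫ x in s, g x ∂ν = 0)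
    ((BorelSpace.measurable_eq (α := V)).trans hbasis.borel_eq_generateFrom) hpi (by simp)
    ?_ ?_ ?_ s hs
  · rintro _ ⟨a, r, hr, rfl⟩
    exact hball a r hr
  · intro t ht h
    have := integral_add_compl ht hg
    rwa [h, h0, zero_add] at this
  · intro f hd hm h
    rw [integral_iUnion hm hd hg.integrableOn]
    simp [h]

end BallGenerate

/-! ### Completeness of the characters -/

section Basis

variable {p : ℕ} [Fact p.Prime] {K : Type*} [NontriviallyNormedField K] [IsUltrametricDist K]
  [NormedAlgebra ℚ_[p] K] [FiniteDimensional ℚ_[p] K] {N : ℕ}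
  [MeasurableSpace K] [BorelSpace K] [SecondCountableTopology K]
  {μ : Measure (Fin N → K)} [μ.IsAddHaarMeasure]

lemma setIntegral_stdChar_eq_indicator_closedBall (hK : IsUnramified p K) (t : Kˣ)
    (a x : Fin N → K) :
    ∫ y in closedBall (0 : Fin N → K) ‖((t⁻¹ : Kˣ) : K)‖, stdChar p (y ⬝ᵥ (x - a)) ∂μ =
      (closedBall a ‖(t : K)‖).indicator
        (fun _ => (μ.real (closedBall (0 : Fin N → K) ‖((t⁻¹ : Kˣ) : K)‖) : ℂ)) x := by
  simp only [dotProduct_comm _ (x - a)]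
  have ht0 : 0 < ‖(t : K)‖ := by simp
  by_cases hx : x ∈ closedBall a ‖(t : K)‖
  · rw [Set.indicator_of_mem hx]
    apply setIntegral_stdChar_of_le
    rw [mem_closedBall, dist_eq_norm] at hx
    rwa [Units.val_inv_eq_inv_val, norm_inv, inv_mul_le_iff₀ ht0, mul_one]
  · rw [Set.indicator_of_notMem hx]
    apply setIntegral_stdChar_of_lt _ hK
    rw [mem_closedBall, dist_eq_norm, not_le] at hx
    rwa [Units.val_inv_eq_inv_val, norm_inv, lt_inv_mul_iff₀ ht0, mul_one]

variable [ProperSpace K]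

/-- A function on the unit ball all of whose Fourier coefficients vanish is zero. -/
lemma ae_eq_zero_of_forall_integral_stdChar (hK : IsUnramified p K) {g : (Fin N → K) → ℂ}
    (hg : Integrable g (μ.restrict (closedBall 0 1)))
    (h : ∀ y : Fin N → K, ∫ x in closedBall (0 : Fin N → K) 1, stdChar p (y ⬝ᵥ x) * g x ∂μ = 0) :
    g =ᵐ[μ.restrict (closedBall 0 1)] 0 := by
  set ν := μ.restrict (closedBall (0 : Fin N → K) 1) with hν
  have : IsFiniteMeasure ν := ⟨by
    rw [hν, Measure.restrict_apply_univ]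
    exact (isCompact_closedBall _ _).measure_lt_top⟩
  -- Radii are restricted to norms of units `t`, so that `‖t⁻¹‖` is available as the radius of the
  -- dual ball.
  refine ae_eq_zero_of_forall_setIntegral_closedBall hg (Set.range fun t : Kˣ => ‖(t : K)‖) ?_ ?_ ?_ ?_
  · rintro _ ⟨t, rfl⟩
    simp
  · intro ε hε
    obtain ⟨t, ht, htε⟩ := NormedField.exists_norm_lt K hε
    exact ⟨‖t‖, ⟨Units.mk0 t (norm_pos_iff.1 ht), rfl⟩, htε⟩
  · simpa [stdChar_zero] using h 0
  · rintro a _ ⟨t, rfl⟩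
    set D := closedBall (0 : Fin N → K) ‖((t⁻¹ : Kˣ) : K)‖ with hD
    have hDtop : μ D < ⊤ := (isCompact_closedBall _ _).measure_lt_top
    have : IsFiniteMeasure (μ.restrict D) := ⟨by rwa [Measure.restrict_apply_univ]⟩
    have hD0 : μ.real D ≠ 0 := by
      refine (ENNReal.toReal_pos (measure_closedBall_pos μ _ ?_).ne' hDtop.ne).ne'
      simp
    have hkernel : ∀ x : Fin N → K, (∫ y in D, stdChar p (y ⬝ᵥ (x - a)) ∂μ) =
        (closedBall a ‖(t : K)‖).indicator (fun _ => (μ.real D : ℂ)) x :=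
      setIntegral_stdChar_eq_indicator_closedBall hK t a
    have hcont : Continuous fun z : (Fin N → K) × (Fin N → K) => stdChar p (z.2 ⬝ᵥ (z.1 - a)) :=
      (isLocallyConstant_stdChar p).continuous.comp (by unfold dotProduct; fun_prop)
    have hint : Integrable (Function.uncurry fun x y : Fin N → K => stdChar p (y ⬝ᵥ (x - a)) * g x)
        (ν.prod (μ.restrict D)) := by
      exact (hg.comp_fst (μ.restrict D)).bdd_mul (c := 1) hcont.aestronglyMeasurable
        (Filter.Eventually.of_forall fun z => (norm_stdChar p _).le)
    -- Integrating first over frequencies in `D` yields a multiple of the integral of `g` over the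
    -- ball at `a`; integrating first over `x` yields vanishing Fourier coefficients.
    have hswap := integral_integral_swap hint
    have hleft : ∀ x, ∫ y in D, stdChar p (y ⬝ᵥ (x - a)) * g x ∂μ =
        μ.real D * (closedBall a ‖(t : K)‖).indicator g x := by
      intro x
      rw [integral_mul_const, hkernel]
      by_cases hx : x ∈ closedBall a ‖(t : K)‖
      · rw [Set.indicator_of_mem hx, Set.indicator_of_mem hx]
      · rw [Set.indicator_of_notMem hx, Set.indicator_of_notMem hx, mul_zero, zero_mul]
    have hright : ∀ y, ∫ x, stdChar p (y ⬝ᵥ (x - a)) * g x ∂ν = 0 := by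
      intro y
      have : ∀ x, stdChar p (y ⬝ᵥ (x - a)) * g x =
          stdChar p (-(y ⬝ᵥ a)) * (stdChar p (y ⬝ᵥ x) * g x) := by
        intro x
        rw [dotProduct_sub, sub_eq_add_neg, stdChar_add]
        ring
      simp only [this]
      rw [integral_const_mul, h, mul_zero]
    simp only [hleft, hright, integral_zero] at hswap
    rw [integral_const_mul, integral_indicator measurableSet_closedBall] at hswap
    exact (mul_eq_zero.1 hswap).resolve_left (by exact_mod_cast hD0)

lemma memLp_ballChar (ξ : Fin N → K) :
    MemLp (ballChar p ξ) 2 (μ.restrict (closedBall 0 1)) :=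
  ((isTestFunction_ballChar ξ).1.continuous.memLp_of_hasCompactSupport
    (isTestFunction_ballChar ξ).2).restrict _

/-- The characters of the unit ball whose frequencies represent the non-trivial cosets of the unit
ball form an orthonormal basis of `L²₀`. -/
lemma exists_hilbertBasis_ballChar (hK : IsUnramified p K) (hμ : μ (closedBall 0 1) = 1)
    {ι : Type*} (ξ : ι → Fin N → K) (hξ : ∀ i, 1 < ‖ξ i‖)
    (hsep : ∀ i j, ‖ξ i - ξ j‖ ≤ 1 → i = j) (hcov : ∀ y, 1 < ‖y‖ → ∃ i, ‖y - ξ i‖ ≤ 1) :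
    ∃ e : HilbertBasis ι ℂ (meanZeroL2 (μ.restrict (closedBall (0 : Fin N → K) 1))), ∀ i,
      ((e i : Lp ℂ 2 (μ.restrict (closedBall 0 1))) : (Fin N → K) → ℂ)
        =ᵐ[μ.restrict (closedBall 0 1)] ballChar p (ξ i) := by
  classical
  set ν := μ.restrict (closedBall (0 : Fin N → K) 1) with hν
  have : IsFiniteMeasure ν := ⟨by
    rw [hν, Measure.restrict_apply_univ, hμ]
    exact ENNReal.one_lt_top⟩
  have := completeSpace_meanZeroL2 (ν := ν)
  have hmem : ∀ i, (memLp_ballChar (p := p) (μ := μ) (ξ i)).toLp ∈ meanZeroL2 ν := by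
    intro i
    rw [mem_meanZeroL2_iff, integral_congr_ae (MemLp.coeFn_toLp _)]
    rw [hν, setIntegral_congr_fun (g := fun x => stdChar p (-(ξ i) ⬝ᵥ x)) measurableSet_closedBall
      fun x hx => by simp only [ballChar_of_mem p _ hx, neg_dotProduct],
      setIntegral_unitBall_stdChar μ hK hμ,
      Set.indicator_of_notMem]
    simpa using hξ i
  let v : ι → meanZeroL2 ν := fun i => ⟨_, hmem i⟩
  have hinner : ∀ i (g : meanZeroL2 ν), inner ℂ (v i) g =
      ∫ x in closedBall (0 : Fin N → K) 1, stdChar p (ξ i ⬝ᵥ x) * (g : Lp ℂ 2 ν) x ∂μ := by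
    intro i g
    rw [Submodule.coe_inner, L2.inner_def]
    refine integral_congr_ae ?_
    filter_upwards [MemLp.coeFn_toLp (memLp_ballChar (p := p) (μ := μ) (ξ i)),
      ae_restrict_mem measurableSet_closedBall] with x hx hxB
    rw [RCLike.inner_apply, hx, ballChar_of_mem p _ hxB, stdChar_neg, Complex.conj_conj, mul_comm]
  have hv : Orthonormal ℂ v := by
    rw [orthonormal_iff_ite]
    intro i j
    have h1 : inner ℂ (v i) (v j) =
        ∫ x in closedBall (0 : Fin N → K) 1, stdChar p ((ξ i - ξ j) ⬝ᵥ x) ∂μ := by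
      rw [hinner]
      refine integral_congr_ae ?_
      filter_upwards [MemLp.coeFn_toLp (memLp_ballChar (p := p) (μ := μ) (ξ j)),
        ae_restrict_mem measurableSet_closedBall] with x hx hxB
      rw [hx, ballChar_of_mem p _ hxB, ← stdChar_add, sub_dotProduct, sub_eq_add_neg]
    rw [h1, setIntegral_unitBall_stdChar μ hK hμ]
    split_ifs with hij
    · subst hij
      simp
    · rw [Set.indicator_of_notMem]
      rw [mem_closedBall_zero_iff]
      exact fun h => hij (hsep i j h)
  have hbot : (Submodule.span ℂ (Set.range v)).orthogonal = ⊥ := by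
    rw [eq_bot_iff]
    intro g hg
    rw [Submodule.mem_bot]
    have hg' : ∀ i, inner ℂ (v i) g = 0 := fun i =>
      Submodule.inner_right_of_mem_orthogonal (Submodule.subset_span (Set.mem_range_self i)) hg
    refine Subtype.ext (Lp.ext ?_)
    refine Filter.EventuallyEq.trans ?_ (Lp.coeFn_zero ℂ 2 ν).symm
    refine ae_eq_zero_of_forall_integral_stdChar (p := p) hK g.2.1 fun y => ?_
    -- Fourier coefficients depend only on the coset of the frequency: the trivial coset gives the
    -- mean, every other one an inner product with some `v i`.
    have hcongr : ∀ z : Fin N → K, ‖y - z‖ ≤ 1 →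
        ∫ x in closedBall (0 : Fin N → K) 1, stdChar p (y ⬝ᵥ x) * (g : Lp ℂ 2 ν) x ∂μ =
          ∫ x in closedBall (0 : Fin N → K) 1, stdChar p (z ⬝ᵥ x) * (g : Lp ℂ 2 ν) x ∂μ := by
      intro z hz
      refine setIntegral_congr_fun measurableSet_closedBall fun x hx => ?_
      rw [mem_closedBall_zero_iff] at hx
      congr 1
      refine stdChar_eq_of_norm_sub_le p ?_
      rw [← sub_dotProduct]
      exact (norm_dotProduct_le _ _).trans (mul_le_one₀ hz (norm_nonneg _) hx)
    rcases le_or_gt ‖y‖ 1 with hy | hy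
    · rw [hcongr 0 (by simpa using hy)]
      simpa [stdChar_zero] using g.2.2
    · obtain ⟨i, hi⟩ := hcov y hy
      rw [hcongr (ξ i) hi, ← hinner, hg']
  refine ⟨HilbertBasis.mkOfOrthogonalEqBot hv hbot, fun i => ?_⟩
  rw [HilbertBasis.coe_mkOfOrthogonalEqBot]
  exact MemLp.coeFn_toLp (memLp_ballChar (ξ i))

end Basis

/-! ### Norms along orbits of the extended action -/

section Dynamics

variable {p : ℕ} {K : Type*} {N : ℕ} {G : Type*} [Group G] {X : Set (Fin N → K)} [MulAction G X]

lemma extUnit_of_mem (σ : G) {x : Fin N → K} (hx : x ∈ X) :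
    extUnit X σ x = ((σ • (⟨x, hx⟩ : X) : X) : Fin N → K) := dif_pos hx

lemma extUnit_of_notMem (σ : G) {x : Fin N → K} (hx : x ∉ X) : extUnit X σ x = x := dif_neg hx

lemma extUnit_mem (σ : G) {x : Fin N → K} (hx : x ∈ X) : extUnit X σ x ∈ X := by
  rw [extUnit_of_mem σ hx]
  exact Subtype.coe_prop _

lemma extUnit_inv_extUnit (σ : G) (x : Fin N → K) : extUnit X σ⁻¹ (extUnit X σ x) = x := by
  by_cases hx : x ∈ X
  · rw [extUnit_of_mem σ hx, extUnit_of_mem _ (Subtype.coe_prop _)]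
    simp
  · rw [extUnit_of_notMem σ hx, extUnit_of_notMem _ hx]

variable [NontriviallyNormedField K]

lemma norm_extUnit_le_one (hX : X ⊆ closedBall 0 1) (σ : G) {x : Fin N → K} (hx : ‖x‖ ≤ 1) :
    ‖extUnit X σ x‖ ≤ 1 := by
  by_cases hxX : x ∈ X
  · simpa using hX (extUnit_mem σ hxX)
  · rwa [extUnit_of_notMem σ hxX]

lemma differentiableAt_extUnit (hXclosed : IsClosed X) {σ : G}
    (hσ : AnalyticOnNhd K (extUnit X σ) X) (x : Fin N → K) :
    DifferentiableAt K (extUnit X σ) x := by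
  by_cases hx : x ∈ X
  · exact (hσ x hx).differentiableAt
  · refine differentiableAt_id.congr_of_eventuallyEq ?_
    filter_upwards [hXclosed.isOpen_compl.mem_nhds hx] with y hy
    exact extUnit_of_notMem σ hy

lemma ext_of_norm_le_one (ρ : ℕ) (σ : G) {x : Fin N → K} (hx : ‖x‖ ≤ 1) :
    ext p X ρ σ x = extUnit X σ x := if_pos hx

lemma ext_of_one_lt_of_le (ρ : ℕ) (σ : G) {x : Fin N → K} (hx : 1 < ‖x‖)
    (hx' : ‖x‖ ≤ (p : ℝ) ^ ρ) :
    ext p X ρ σ x = ((p : K) ^ ρ)⁻¹ • extUnit X σ ((p : K) ^ ρ • x) := by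
  rw [ext, if_neg hx.not_ge, if_pos hx']

lemma ext_of_lt (hp : 1 ≤ p) (ρ : ℕ) (σ : G) {x : Fin N → K} (hx : (p : ℝ) ^ ρ < ‖x‖) :
    ext p X ρ σ x = x := by
  have h1 : (1 : ℝ) ≤ (p : ℝ) ^ ρ := one_le_pow₀ (by exact_mod_cast hp)
  rw [ext, if_neg (by linarith), if_neg hx.not_ge]

variable [Fact p.Prime] [NormedAlgebra ℚ_[p] K]

lemma norm_prime_pow_smul (ρ : ℕ) (x : Fin N → K) :
    ‖(p : K) ^ ρ • x‖ = ((p : ℝ) ^ ρ)⁻¹ * ‖x‖ := by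
  rw [norm_smul, norm_pow, norm_natCast_prime, inv_pow]

lemma norm_prime_pow_inv_smul (ρ : ℕ) (x : Fin N → K) :
    ‖((p : K) ^ ρ)⁻¹ • x‖ = (p : ℝ) ^ ρ * ‖x‖ := by
  rw [norm_smul, norm_inv, norm_pow, norm_natCast_prime, inv_pow, inv_inv]

lemma prime_pow_ne_zero (ρ : ℕ) : (p : K) ^ ρ ≠ 0 := by
  refine pow_ne_zero _ ?_
  have := (Fact.out : p.Prime).pos
  rw [← norm_pos_iff, norm_natCast_prime]
  positivity

/-- If the extended maps form an action, then the group preserves the ball of radius `p ^ (-ρ)`. -/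
lemma norm_extUnit_le_of_extIsAction (hX : X ⊆ closedBall 0 1) {ρ : ℕ}
    (h : ExtIsAction (G := G) p X ρ) (σ : G) {y : Fin N → K} (hy : ‖y‖ ≤ ((p : ℝ) ^ ρ)⁻¹) :
    ‖extUnit X σ y‖ ≤ ((p : ℝ) ^ ρ)⁻¹ := by
  have hp1 : (1 : ℝ) < p := by exact_mod_cast (Fact.out : p.Prime).one_lt
  have hpρ : (0 : ℝ) < (p : ℝ) ^ ρ := by positivity
  by_contra! hz
  set z := extUnit X σ y with hzdef
  have hy1 : ‖y‖ ≤ 1 := hy.trans (inv_le_one_of_one_le₀ (one_le_pow₀ hp1.le))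
  have hz1 : ‖z‖ ≤ 1 := norm_extUnit_le_one hX σ hy1
  set x := ((p : K) ^ ρ)⁻¹ • z with hx
  have hxn : ‖x‖ = (p : ℝ) ^ ρ * ‖z‖ := norm_prime_pow_inv_smul ρ z
  have hx1 : 1 < ‖x‖ := by rwa [hxn, ← inv_lt_iff_one_lt_mul₀' hpρ]
  have hx2 : ‖x‖ ≤ (p : ℝ) ^ ρ := by rw [hxn]; exact mul_le_of_le_one_right hpρ.le hz1
  -- The point `x` lies in the rescaled shell, but `σ⁻¹` sends it into the unit ball. There `σ` acts
  -- by its unscaled form and cannot bring it back, contradicting the action law.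
  have h1 : ext p X ρ σ⁻¹ x = ((p : K) ^ ρ)⁻¹ • y := by
    rw [ext_of_one_lt_of_le ρ _ hx1 hx2, hx, smul_inv_smul₀ (prime_pow_ne_zero ρ), hzdef,
      extUnit_inv_extUnit]
  have h2 : ‖((p : K) ^ ρ)⁻¹ • y‖ ≤ 1 := by
    rw [norm_prime_pow_inv_smul, ← le_inv_mul_iff₀ hpρ, mul_one]
    exact hy
  have h3 := h.2 σ σ⁻¹ x
  rw [mul_inv_cancel, h.1, h1, ext_of_norm_le_one ρ σ h2] at h3
  have := norm_extUnit_le_one hX σ h2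
  rw [← h3] at this
  linarith

variable [IsUltrametricDist K]

/-- A map which preserves arbitrarily small balls around the origin and is differentiable there
does not increase norms near the origin. -/
lemma norm_le_norm_of_forall_ball (hK : IsUnramified p K) {g : (Fin N → K) → (Fin N → K)}
    {L : (Fin N → K) →L[K] (Fin N → K)} {δ : ℝ}
    (hL : ∀ x, ‖x‖ ≤ δ → ‖g x - L x‖ ≤ ‖x‖) {ρ : ℕ} (hρ : ((p : ℝ) ^ ρ)⁻¹ ≤ δ)
    (hg : ∀ x, ‖x‖ ≤ ((p : ℝ) ^ ρ)⁻¹ → ‖g x‖ ≤ ((p : ℝ) ^ ρ)⁻¹) {x : Fin N → K} (hx : ‖x‖ ≤ δ) :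
    ‖g x‖ ≤ ‖x‖ := by
  have hp1 : (1 : ℝ) < p := by exact_mod_cast (Fact.out : p.Prime).one_lt
  have hp0 : (0 : ℝ) < p := by linarith
  have hLx : ‖L x‖ ≤ ‖x‖ := by
    rcases eq_or_ne x 0 with rfl | hx0
    · simp
    obtain ⟨m, hm⟩ := exists_pi_norm_eq_zpow hK hx0
    have hscale : ∀ v : Fin N → K, ‖(p : K) ^ (ρ + m) • v‖ = ((p : ℝ) ^ ρ)⁻¹ * ((p : ℝ) ^ m)⁻¹ * ‖v‖ := by
      intro v
      rw [norm_smul, norm_zpow, norm_natCast_prime, inv_zpow, zpow_add₀ hp0.ne', mul_inv,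
        zpow_natCast]
    -- Rescaling `x` to norm exactly `p^(-ρ)` lets the preserved ball bound `L y`; linearity carries
    -- the bound back to `x`.
    set y := (p : K) ^ (ρ + m) • x with hy
    have hyn : ‖y‖ = ((p : ℝ) ^ ρ)⁻¹ := by
      rw [hy, hscale, hm, mul_assoc, inv_mul_cancel₀ (zpow_pos hp0 m).ne', mul_one]
    have hLy : ‖L y‖ ≤ ((p : ℝ) ^ ρ)⁻¹ := by
      rw [← sub_sub_cancel (g y) (L y)]
      exact (norm_sub_le_max _ _).trans
        (max_le (hg y hyn.le) ((hL y (hyn.le.trans hρ)).trans hyn.le))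
    rw [hy, map_smul, hscale, mul_assoc, mul_le_iff_le_one_right (by positivity),
      inv_mul_le_iff₀ (zpow_pos hp0 m), mul_one, ← hm] at hLy
    exact hLy
  rw [← sub_add_cancel (g x) (L x)]
  exact (IsUltrametricDist.norm_add_le_max _ _).trans (max_le (hL x hx) hLx)

variable [Finite G]

/-- For large `ρ`, if the extended maps form an action, then their norms are constant on the cosets
of the unit ball other than the unit ball itself, and they do not vanish there. -/
lemma exists_forall_norm_ext_eq [ProperSpace K] (hK : IsUnramified p K) (hXclosed : IsClosed X) (hX : X ⊆ closedBall 0 1)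
    (hG : ∀ σ : G, AnalyticOnNhd K (extUnit X σ) X) :
    ∃ ρ₀ : ℕ, ∀ ρ : ℕ, ρ₀ ≤ ρ → ExtIsAction (G := G) p X ρ → ∀ (σ : G) (ξ y : Fin N → K),
      1 < ‖ξ‖ → ‖y - ξ‖ ≤ 1 →
        ext p X ρ σ ξ ≠ 0 ∧ ‖ext p X ρ σ y‖ = ‖ext p X ρ σ ξ‖ := by
  have hp1 : (1 : ℝ) < p := by exact_mod_cast (Fact.out : p.Prime).one_lt
  -- The constant `1` in the error bound suffices: by the ultrametric inequality such an error
  -- cannot push the norm above `‖x‖`.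
  have hd : ∀ σ : G, ∀ᶠ x in nhds (0 : Fin N → K),
      ‖extUnit X σ x - extUnit X σ 0 - fderiv K (extUnit X σ) 0 x‖ ≤ ‖x‖ := by
    intro σ
    have h1 := (differentiableAt_extUnit hXclosed (hG σ) 0).hasFDerivAt
    have h2 := h1.isLittleO.bound one_pos
    simpa using h2
  obtain ⟨δ, hδ, hδ'⟩ := Metric.nhds_basis_closedBall.eventually_iff.1 (Filter.eventually_all.2 hd)
  have hu : ∀ σ : G, ∃ ε > 0, ∀ x ∈ closedBall (0 : Fin N → K) 1, ∀ y ∈ closedBall (0 : Fin N → K) 1,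
      dist x y < ε → dist (extUnit X σ x) (extUnit X σ y) < δ := by
    intro σ
    have hc : ContinuousOn (extUnit X σ) (closedBall 0 1) := fun x _ =>
      (differentiableAt_extUnit hXclosed (hG σ) x).continuousAt.continuousWithinAt
    have := (isCompact_closedBall (0 : Fin N → K) 1).uniformContinuousOn_of_continuous hc
    exact Metric.uniformContinuousOn_iff.1 this δ hδ
  choose ε hε hεu using hu
  have hlim : Filter.Tendsto (fun ρ : ℕ => ((p : ℝ) ^ ρ)⁻¹) Filter.atTop (nhds 0) := by
    simpa only [inv_pow] using
      tendsto_pow_atTop_nhds_zero_of_lt_one (inv_nonneg.2 (zero_lt_one.trans hp1).le)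
        (inv_lt_one_of_one_lt₀ hp1)
  -- The preserved ball must fit in the linearization ball, be finer than the modulus of continuity,
  -- and exclude `σ 0` unless it is zero.
  have hev : ∀ᶠ ρ : ℕ in Filter.atTop, ((p : ℝ) ^ ρ)⁻¹ < δ ∧ ∀ σ : G, ((p : ℝ) ^ ρ)⁻¹ < ε σ ∧
      (extUnit X σ 0 ≠ 0 → ((p : ℝ) ^ ρ)⁻¹ < ‖extUnit X σ 0‖) := by
    refine (hlim.eventually_lt_const hδ).and (Filter.eventually_all.2 fun σ =>
      (hlim.eventually_lt_const (hε σ)).and ?_)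
    by_cases h0 : extUnit X σ 0 = 0
    · simp [h0]
    · filter_upwards [hlim.eventually_lt_const (norm_pos_iff.2 h0)] with ρ hρ _ using hρ
  obtain ⟨ρ₀, hρ₀⟩ := Filter.eventually_atTop.1 hev
  refine ⟨ρ₀, fun ρ hρ hact σ ξ y hξ hy => ?_⟩
  obtain ⟨hρδ, hρσ⟩ := hρ₀ ρ hρ
  have hpρ : (0 : ℝ) < (p : ℝ) ^ ρ := by positivity
  have hball : ∀ σ : G, ∀ x : Fin N → K, ‖x‖ ≤ ((p : ℝ) ^ ρ)⁻¹ →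
      ‖extUnit X σ x‖ ≤ ((p : ℝ) ^ ρ)⁻¹ :=
    fun σ x hx => norm_extUnit_le_of_extIsAction hX hact σ hx
  have hzero : ∀ σ : G, extUnit X σ 0 = 0 := by
    intro σ
    by_contra h0
    exact ((hρσ σ).2 h0).not_ge (hball σ 0 (by simp))
  have hle : ∀ σ : G, ∀ x : Fin N → K, ‖x‖ ≤ δ → ‖extUnit X σ x‖ ≤ ‖x‖ := by
    intro σ x hx
    refine norm_le_norm_of_forall_ball hK (L := fderiv K (extUnit X σ) 0) (fun x hx => ?_)
      hρδ.le (hball σ) hx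
    have := hδ' (mem_closedBall_zero_iff.2 hx) σ
    rwa [hzero, sub_zero] at this
  have heq : ∀ σ : G, ∀ x : Fin N → K, ‖x‖ ≤ δ → ‖extUnit X σ x‖ = ‖x‖ := by
    intro σ x hx
    refine le_antisymm (hle σ x hx) ?_
    have := hle σ⁻¹ (extUnit X σ x) ((hle σ x hx).trans hx)
    rwa [extUnit_inv_extUnit] at this
  have hyξ : ‖y‖ = ‖ξ‖ := norm_eq_of_norm_sub_lt (hy.trans_lt hξ)
  rcases lt_or_ge ((p : ℝ) ^ ρ) ‖ξ‖ with hfar | hnear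
  · rw [ext_of_lt (Fact.out : p.Prime).one_lt.le ρ σ hfar,
      ext_of_lt (Fact.out : p.Prime).one_lt.le ρ σ (hyξ ▸ hfar)]
    exact ⟨norm_pos_iff.1 (one_pos.trans hξ), hyξ⟩
  rw [ext_of_one_lt_of_le ρ σ hξ hnear, ext_of_one_lt_of_le ρ σ (hyξ ▸ hξ) (hyξ ▸ hnear),
    norm_prime_pow_inv_smul, norm_prime_pow_inv_smul]
  set a := (p : K) ^ ρ • ξ with ha
  set b := (p : K) ^ ρ • y with hb
  have ha0 : a ≠ 0 := smul_ne_zero (prime_pow_ne_zero ρ) (norm_pos_iff.1 (one_pos.trans hξ))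
  have ha1 : ‖a‖ ≤ 1 := by
    rw [ha, norm_prime_pow_smul, inv_mul_le_iff₀ hpρ, mul_one]
    exact hnear
  have hba : ‖b - a‖ ≤ ((p : ℝ) ^ ρ)⁻¹ := by
    rw [ha, hb, ← smul_sub, norm_prime_pow_smul]
    exact mul_le_of_le_one_right (inv_nonneg.2 hpρ.le) hy
  have hbn : ‖b‖ = ‖a‖ := by rw [ha, hb, norm_prime_pow_smul, norm_prime_pow_smul, hyξ]
  constructor
  · refine smul_ne_zero (inv_ne_zero (prime_pow_ne_zero ρ)) fun h0 => ha0 ?_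
    rw [← extUnit_inv_extUnit (X := X) σ a, h0, hzero]
  congr 1
  rcases le_or_gt ‖a‖ δ with haδ | haδ
  · rw [heq σ a haδ, heq σ b (hbn ▸ haδ), hbn]
  -- Were the image within `δ`, norm preservation by `σ⁻¹` would put `a` there too.
  · have hσa : δ < ‖extUnit X σ a‖ := by
      by_contra! h
      have := heq σ⁻¹ _ h
      rw [extUnit_inv_extUnit] at this
      linarith
    refine norm_eq_of_norm_sub_lt (lt_trans ?_ hσa)
    rw [← dist_eq_norm]
    refine hεu σ b (by simpa [hbn] using ha1) a (by simpa using ha1) ?_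
    rw [dist_eq_norm]
    exact hba.trans_lt (hρσ σ).1

end Dynamics

/-! ### Digit expansions of the cosets -/

section Frequencies

variable {p : ℕ} {K : Type*} [NontriviallyNormedField K] {R : Set K} {N : ℕ}

lemma IsDigitSystem.eq_of_norm_sub_le (hR : IsDigitSystem p R) {r s : K} (hr : r ∈ R) (hs : s ∈ R)
    (h : ‖r - s‖ ≤ ‖(p : K)‖) : r = s :=
  (hR.existsUnique_digit r (hR.integral r hr)).unique ⟨hr, by simp⟩ ⟨hs, h⟩

lemma IsDigitSystem.norm_eq_one (hR : IsDigitSystem p R) (hK : IsUnramified p K)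
    {k : Fin N → K} (hk : ∀ j, k j ∈ R) (hk0 : k ≠ 0) : ‖k‖ = 1 := by
  refine le_antisymm ((pi_norm_le_iff_of_nonneg zero_le_one).2 fun j => hR.integral _ (hk j)) ?_
  obtain ⟨j, hj⟩ := Function.ne_iff.1 hk0
  refine le_trans ?_ (norm_le_pi_norm k j)
  by_contra! h
  exact hj (hR.eq_of_norm_sub_le (hk j) hR.zero_mem (by simpa using hK _ h))

variable [IsUltrametricDist K]

lemma mk_eq_mk_iff_norm_sub_le {x y : K} :
    (QuotientAddGroup.mk x : K ⧸ intSubgroup K) = QuotientAddGroup.mk y ↔ ‖x - y‖ ≤ 1 := by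
  rw [QuotientAddGroup.eq, neg_add_eq_sub, norm_sub_rev]
  rfl

variable [Fact p.Prime] [NormedAlgebra ℚ_[p] K] in
/-- The indices `(γ, b, k)` parametrise the cosets of the unit ball other than the unit ball itself:
the coset of `(γ, b, k)` contains the point `p ^ γ (-p⁻¹ k + η)` with `p ^ γ η` representing `b`. -/
lemma exists_frequencies (hK : IsUnramified p K) (hR : IsDigitSystem p R) :
    ∃ ξ : indexSet p R N → Fin N → K,
      (∀ i, ‖ξ i‖ = (p : ℝ) ^ (1 - i.1.1)) ∧
      (∀ i, ∃ η : Fin N → K, ‖η‖ ≤ 1 ∧ ξ i = (p : K) ^ i.1.1 • (-((p : K)⁻¹ • i.1.2.2) + η)) ∧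
      (∀ i j, ‖ξ i - ξ j‖ ≤ 1 → i = j) ∧
      ∀ y, 1 < ‖y‖ → ∃ i, ‖y - ξ i‖ ≤ 1 := by
  have hp1 : (1 : ℝ) < p := by exact_mod_cast (Fact.out : p.Prime).one_lt
  have hp0 : (0 : ℝ) < p := by linarith
  have hpn : ‖(p : K)‖ = (p : ℝ)⁻¹ := norm_natCast_prime p
  have hpK : (p : K) ≠ 0 := by rw [← norm_pos_iff, hpn]; positivity
  have hlift : ∀ i : indexSet p R N, ∃ z : Fin N → K, ‖z‖ ≤ (p : ℝ) ^ (-i.1.1) ∧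
      ∀ j, (QuotientAddGroup.mk (z j) : K ⧸ intSubgroup K) = i.1.2.1 j := by
    intro i
    choose z hz hz' using i.2.2.1
    exact ⟨z, (pi_norm_le_iff_of_nonneg (zpow_nonneg hp0.le _)).2 hz, hz'⟩
  choose z hz hzb using hlift
  -- The digit term strictly dominates the lift `z i` of `b`, so it alone fixes the norm.
  let ξ : indexSet p R N → Fin N → K := fun i => z i - (p : K) ^ (i.1.1 - 1) • i.1.2.2
  have hlead : ∀ (m : ℤ) (k : Fin N → K), ‖(p : K) ^ (m - 1) • k‖ = (p : ℝ) ^ (1 - m) * ‖k‖ := by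
    intro m k
    rw [norm_smul, norm_zpow, hpn, inv_zpow', neg_sub]
  have hnorm : ∀ i, ‖ξ i‖ = (p : ℝ) ^ (1 - i.1.1) := by
    intro i
    have h1 : ‖-((p : K) ^ (i.1.1 - 1) • i.1.2.2)‖ = (p : ℝ) ^ (1 - i.1.1) := by
      rw [norm_neg, hlead, hR.norm_eq_one hK i.2.2.2.1 i.2.2.2.2, mul_one]
    rw [← h1]
    refine norm_eq_of_norm_sub_lt ?_
    rw [h1, sub_neg_eq_add, sub_add_cancel]
    exact (hz i).trans_lt (zpow_lt_zpow_right₀ hp1 (by omega))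
  have hone : ∀ i : indexSet p R N, (1 : ℝ) < (p : ℝ) ^ (1 - i.1.1) := fun i =>
    one_lt_zpow₀ hp1 (by have := i.2.1; omega)
  refine ⟨ξ, hnorm, fun i => ⟨(p : K) ^ (-i.1.1) • z i, ?_, ?_⟩, fun i j hij => ?_, fun y hy => ?_⟩
  · rw [norm_smul, norm_zpow, hpn, inv_zpow', neg_neg, mul_comm]
    calc ‖z i‖ * (p : ℝ) ^ i.1.1 ≤ (p : ℝ) ^ (-i.1.1) * (p : ℝ) ^ i.1.1 := by
          gcongr; exact hz i
      _ = 1 := by rw [← zpow_add₀ hp0.ne']; simp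
  · rw [smul_add, smul_neg, smul_smul, smul_smul, ← zpow_add₀ hpK, add_neg_cancel, zpow_zero,
      one_smul, ← zpow_sub_one₀ hpK, neg_add_eq_sub]
  · have hγ : i.1.1 = j.1.1 := by
      have h1 : ‖ξ i‖ = ‖ξ j‖ :=
        norm_eq_of_norm_sub_lt (hij.trans_lt (by rw [hnorm]; exact hone j))
      rw [hnorm, hnorm] at h1
      have := zpow_right_injective₀ hp0 hp1.ne' h1
      omega
    have hone' : (1 : ℝ) ≤ (p : ℝ) ^ (-i.1.1) := one_le_zpow₀ hp1.le (by have := i.2.1; omega)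
    have hk : i.1.2.2 = j.1.2.2 := by
      have h1 : (p : K) ^ (i.1.1 - 1) • (i.1.2.2 - j.1.2.2) = (z i - z j) - (ξ i - ξ j) := by
        simp only [ξ, ← hγ, smul_sub]
        abel
      have h2 : ‖(p : K) ^ (i.1.1 - 1) • (i.1.2.2 - j.1.2.2)‖ ≤ (p : ℝ) ^ (-i.1.1) := by
        rw [h1]
        refine (norm_sub_le_max _ _).trans (max_le ((norm_sub_le_max _ _).trans
          (max_le (hz i) (hγ ▸ hz j))) (hij.trans hone'))
      rw [hlead, sub_eq_add_neg, add_comm, zpow_add₀ hp0.ne', zpow_one, mul_assoc,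
        mul_le_iff_le_one_right (zpow_pos hp0 _), ← le_inv_mul_iff₀ hp0, mul_one, ← hpn] at h2
      funext l
      exact hR.eq_of_norm_sub_le (i.2.2.2.1 l) (j.2.2.2.1 l)
        ((norm_le_pi_norm (i.1.2.2 - j.1.2.2) l).trans h2)
    have hb : i.1.2.1 = j.1.2.1 := by
      funext l
      rw [← hzb i, ← hzb j, mk_eq_mk_iff_norm_sub_le]
      have h1 : ξ i - ξ j = z i - z j := by
        simp only [ξ, ← hγ, hk]
        abel
      rw [h1] at hij
      exact (norm_le_pi_norm (z i - z j) l).trans hij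
    exact Subtype.ext (Prod.ext hγ (Prod.ext hb hk))
  · obtain ⟨m, hm⟩ := exists_pi_norm_eq_zpow hK (norm_pos_iff.1 (one_pos.trans hy))
    have hm0 : 0 < m := by rwa [hm, one_lt_zpow_iff_right₀ hp1] at hy
    have hy1 : ‖(p : K) ^ m • y‖ = 1 := by
      rw [norm_smul, norm_zpow, hpn, hm, inv_zpow, inv_mul_cancel₀ (zpow_pos hp0 m).ne']
    -- The sign matches the leading term `-p^(γ-1) k` with `γ = 1 - m`.
    have hdig : ∀ j, ∃ r, r ∈ R ∧ ‖-((p : K) ^ m • y) j - r‖ ≤ ‖(p : K)‖ := fun j =>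
      (hR.existsUnique_digit _ (by
        rw [← hy1, ← norm_neg ((p : K) ^ m • y)]
        exact norm_le_pi_norm (-((p : K) ^ m • y)) j)).exists
    choose k hkR hk using hdig
    have hk' : ‖-((p : K) ^ m • y) - k‖ ≤ (p : ℝ)⁻¹ := by
      rw [← hpn]
      exact (pi_norm_le_iff_of_nonneg (norm_nonneg _)).2 hk
    have hk0 : k ≠ 0 := by
      rintro rfl
      rw [sub_zero, norm_neg, hy1] at hk'
      exact (inv_lt_one_of_one_lt₀ hp1).not_ge hk'
    -- Removing the leading digit from `y` leaves the representative of `b`.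
    set w : Fin N → K := y + (p : K) ^ (1 - m - 1) • k with hw
    have hwn : ‖w‖ ≤ (p : ℝ) ^ (-(1 - m)) := by
      have h1 : w = -((p : K) ^ (1 - m - 1) • (-((p : K) ^ m • y) - k)) := by
        rw [hw, smul_sub, smul_neg, smul_smul, ← zpow_add₀ hpK]
        simp [add_comm]
      rw [h1, norm_neg, hlead, neg_sub, sub_sub_cancel, zpow_sub_one₀ hp0.ne']
      gcongr
    let i : indexSet p R N := ⟨(1 - m, fun j => QuotientAddGroup.mk (w j), k), by
      refine ⟨?_, fun j => ⟨w j, (norm_le_pi_norm w j).trans hwn, rfl⟩, hkR, hk0⟩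
      change 1 - m ≤ 0
      omega⟩
    refine ⟨i, ?_⟩
    have h1 : y - ξ i = w - z i := by
      simp only [ξ, hw, i]
      abel
    rw [h1, pi_norm_le_iff_of_nonneg zero_le_one]
    intro j
    rw [Pi.sub_apply, ← mk_eq_mk_iff_norm_sub_le, hzb]

/-- A family of points of bounded norm which lie in distinct cosets of the unit ball is finite. -/
lemma finite_of_separated [ProperSpace K] {ι : Type*} {ξ : ι → Fin N → K}
    (hsep : ∀ i j, ‖ξ i - ξ j‖ ≤ 1 → i = j) (r : ℝ) : {i | ‖ξ i‖ ≤ r}.Finite := by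
  obtain ⟨t, ht, htc⟩ := Metric.totallyBounded_iff.1
    (isCompact_closedBall (0 : Fin N → K) r).totallyBounded 1 one_pos
  have hmem : ∀ i ∈ {i | ‖ξ i‖ ≤ r}, ∃ y ∈ t, dist (ξ i) y < 1 := by
    intro i hi
    simpa using htc (mem_closedBall_zero_iff.2 hi)
  choose! c hc hd using hmem
  refine Set.Finite.of_finite_image (f := c) (ht.subset (Set.image_subset_iff.2 hc)) ?_
  intro i hi j hj hij
  refine hsep i j ?_
  rw [← dist_eq_norm]
  refine (dist_triangle_max _ (c i) _).trans (max_le (hd i hi).le ?_)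
  rw [hij, dist_comm]
  exact (hd j hj).le

end Frequencies

end TwistedHeat

/-! ### Assembly of the eigenbasis -/

theorem mainTheorem8
    -- an unramified finite extension `K` of `ℚ_p`, and a system of digits
    (p : ℕ) [Fact p.Prime] {K : Type*} [NontriviallyNormedField K] [IsUltrametricDist K]
    [NormedAlgebra ℚ_[p] K] [FiniteDimensional ℚ_[p] K]
    (hK : TwistedHeat.IsUnramified p K)
    (R : Set K) (hR : TwistedHeat.IsDigitSystem p R)
    -- the normalised Haar measure on `K ^ N`
    {N : ℕ} [MeasurableSpace K] [BorelSpace K]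
    (μ : MeasureTheory.Measure (Fin N → K)) [μ.IsAddHaarMeasure]
    (hμ : μ (Metric.closedBall 0 1) = 1)
    -- a finite group acting by bi-analytic maps on a compact open subset of the unit ball
    {G : Type*} [Group G] [Finite G]
    (X : Set (Fin N → K)) (hXopen : IsOpen X) (hXcompact : IsCompact X)
    (hXball : X ⊆ Metric.closedBall 0 1) [MulAction G X]
    (hG : ∀ σ : G, AnalyticOnNhd K (TwistedHeat.extUnit X σ) X) :
    -- for all large `ρ` for which the extended maps are an action of `G` on `K ^ N`
    ∃ ρ₀ : ℕ, ∀ ρ : ℕ, ρ₀ ≤ ρ → TwistedHeat.ExtIsAction (G := G) p X ρ →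
      ∀ (lam : ℝ) (f : (Fin N → K) → ℝ), TwistedHeat.IsSymbol f lam →
        ∃ (ω : TwistedHeat.indexSet p R N → (Fin N → K) → ℂ)
          (e : HilbertBasis (TwistedHeat.indexSet p R N) ℂ
            (TwistedHeat.meanZeroL2 (μ.restrict (Metric.closedBall 0 1))))
          (γ : G → TwistedHeat.indexSet p R N → ℤ),
          (∀ i, TwistedHeat.IsTestFunction (ω i) ∧
            (∀ x, x ∉ Metric.closedBall (0 : Fin N → K) 1 → ω i x = 0) ∧
            ((e i : MeasureTheory.Lp ℂ 2 (μ.restrict (Metric.closedBall 0 1))) :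
              (Fin N → K) → ℂ) =ᵐ[μ.restrict (Metric.closedBall 0 1)] ω i) ∧
          (∀ (σ : G) i,
            TwistedHeat.opJ p μ f (TwistedHeat.ext p X ρ σ) (ω i) =
              fun x => (TwistedHeat.radialProfile f ((p : ℝ) ^ (1 - γ σ i)) : ℂ) * ω i x) ∧
          (∀ (σ : G) i, ∃ η : Fin N → K, ‖η‖ ≤ 1 ∧
            (p : ℝ) ^ (1 - γ σ i) =
              ‖TwistedHeat.ext p X ρ σ
                ((p : K) ^ i.1.1 • (-((p : K)⁻¹ • i.1.2.2) + η))‖) ∧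
          (∀ i, γ 1 i = i.1.1) ∧
          (∀ m : ℤ, {i : TwistedHeat.indexSet p R N | i.1.1 = m}.Finite) := by
  have : ProperSpace K := FiniteDimensional.proper ℚ_[p] K
  have hp1 : (1 : ℝ) < p := by exact_mod_cast (Fact.out : p.Prime).one_lt
  have hp0 : (0 : ℝ) < p := by linarith
  obtain ⟨ρ₀, hρ₀⟩ :=
    TwistedHeat.exists_forall_norm_ext_eq (p := p) hK hXcompact.isClosed hXball hG
  refine ⟨ρ₀, fun ρ hρ hact lam f hf => ?_⟩
  obtain ⟨ξ, hnorm, hform, hsep, hcov⟩ := TwistedHeat.exists_frequencies (N := N) hK hR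
  have hone : ∀ i, 1 < ‖ξ i‖ := fun i => by
    rw [hnorm]
    exact one_lt_zpow₀ hp1 (by have := i.2.1; omega)
  have hconst := hρ₀ ρ hρ hact
  -- Nonvanishing of `σ ξ` is needed here, since only nonzero vectors have a power of `p` as norm.
  have hexp : ∀ (σ : G) i, ∃ m : ℤ, (p : ℝ) ^ (1 - m) = ‖TwistedHeat.ext p X ρ σ (ξ i)‖ := by
    intro σ i
    obtain ⟨m, hm⟩ := TwistedHeat.exists_pi_norm_eq_zpow hK
      (hconst σ (ξ i) (ξ i) (hone i) (by simp)).1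
    exact ⟨1 - m, by rw [hm, sub_sub_cancel]⟩
  choose γ hγ using hexp
  obtain ⟨e, he⟩ := TwistedHeat.exists_hilbertBasis_ballChar (p := p) hK hμ ξ hone hsep hcov
  refine ⟨fun i => TwistedHeat.ballChar p (ξ i), e, γ, fun i => ⟨?_, ?_, he i⟩, fun σ i => ?_,
    fun σ i => ?_, fun i => ?_, fun m => ?_⟩
  · exact TwistedHeat.isTestFunction_ballChar (ξ i)
  · exact fun x hx => TwistedHeat.ballChar_of_notMem p (ξ i) hx
  · refine TwistedHeat.opJ_ballChar μ hK hμ fun y hy => ?_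
    rw [hγ, TwistedHeat.radialProfile_norm hf.radial]
    exact hf.radial _ _ (hconst σ (ξ i) y (hone i) hy).2
  · obtain ⟨η, hη, hξη⟩ := hform i
    exact ⟨η, hη, by rw [hγ, hξη]⟩
  · have h := hγ 1 i
    rw [hact.1, hnorm] at h
    have := zpow_right_injective₀ hp0 hp1.ne' h
    omega
  · refine (TwistedHeat.finite_of_separated hsep ((p : ℝ) ^ (1 - m))).subset ?_
    rintro i rfl
    exact (hnorm i).le
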